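/- Let $n\ge 1$, let $C$ be a Riemann surface (a complex manifold of dimension one), and let $\rho:P\to C$ be a holomorphic principal $SL_n(\mathbb C)$-bundle with right action, endowed with a holomorphic connection $\nabla$ (automatically flat, since $\dim C=1$). Let $\omega$ be its connection form: a holomorphic $\mathfrak{sl}_n(\mathbb C)$-valued 1-form on $P$ with $\omega(\xi^\#)=\xi$ for the fundamental vector field $\xi^\#$ of every $\xi\in\mathfrak{sl}_n(\mathbb C)$, and $R_g^*\omega=\mathrm{Ad}(g^{-1})\,\omega$ for $g\in SL_n(\mathbb C)$. Let $\mathcal H=\ker\omega\subset TP$ be its horizontal distribution. Write $\mathfrak{sl}_n(\mathbb C)=\mathfrak n^+\oplus\mathfrak h\oplus\mathfrak n^-$ (strictly upper triangular, diagonal and strictly lower triangular matrices), $\mathfrak b^+=\mathfrak h\oplus\mathfrak n^+$, let $B^+\subset SL_n(\mathbb C)$ be the subgroup of upper triangular matrices, and let $(\cdot)^-$ be the projection to $\mathfrak n^-$ along $\mathfrak b^+$, with $\omega^-=(\omega)^-$. Let $X=P/B^+$ be the relative flag manifold with its quotient complex structure, $\tilde\pi:P\to X$ the projection, and $\mathcal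 F=\tilde\pi_*\mathcal H\subset TX$ the image of $\mathcal H$ under $d\tilde\pi$. Then: 1. $\omega^-(\xi^\#)=0$ for every $\xi\in\mathfrak b^+$. 2. $\omega^-$ is horizontal with respect to $\tilde\pi$: $\omega^-(v)=0$ whenever $d\tilde\pi(v)=0$. 3. $\mathcal F$ is a holomorphic foliation of $X$ by curves (a distribution of rank one, locally spanned by a nowhere vanishing holomorphic vector field), and $\mathcal F_{\tilde\pi(p)}=d\tilde\pi(\mathcal H_p)$ for every $p\in P$. 4. $\omega^-$ descends to $X$: there is a unique 1-form $\bar\omega^-$ on $X$ with values in the associated vector bundle $P\times_{B^+}\mathfrak n^-$, where $b\in B^+$ acts on $\mathfrak n^-\cong\mathfrak{sl}_n(\mathbb C)/\mathfrak b^+$ by $\eta\mapsto(b\eta b^{-1})^-$, whose pull-back to $P$ is $\omega^-$; that is, $\bar\omega^-(d\tilde\pi(v))$ is the class of $(p,\omega^-(v))$ for all $p\in P$, $v\in T_pP$. The form $\bar\omega^-$ is holomorphic. 5. $\mathcal F$ is cut out by the equation $\omega^-=0$: a tangent vector $w$ of $X$ lies in $\mathcal F$ if and only if $\bar\omega^-(w)=0$.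 -/

import Mathlib

open scoped Manifold ContDiff Topology RightActions
open Matrix Set

noncomputable section

/-! ### The complex Lie group `SL_n(ℂ)` as a complex manifold -/

/-- The group `SL_n(ℂ)`. -/
abbrev SLn (n : ℕ) : Type := Matrix.SpecialLinearGroup (Fin n) ℂ

/-- The space `𝔰𝔩_n(ℂ)` of trace-free matrices. -/
def sln (n : ℕ) : Submodule ℂ (Matrix (Fin n) (Fin n) ℂ) :=
  LinearMap.ker (Matrix.traceLinearMap (Fin n) ℂ ℂ)

/-- The positions of a matrix other than the upper left corner. -/
abbrev SLIdx (n : ℕ) [NeZero n] : Type := {q : Fin n × Fin n // q ≠ (0, 0)}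

/-- The model space of `SL_n(ℂ)`: near the identity, the upper left entry of a matrix of
determinant one is determined by the others, which serve as coordinates. -/
abbrev SLModel (n : ℕ) [NeZero n] : Type := SLIdx n → ℂ

namespace SLn

theorem contDiff_det {n : ℕ} {E : Type*} [NormedAddCommGroup E] [NormedSpace ℂ E]
    {A : E → Matrix (Fin n) (Fin n) ℂ} (hA : ∀ i j, ContDiff ℂ ω fun e => A e i j) :
    ContDiff ℂ ω fun e => (A e).det := by
  simp only [Matrix.det_apply]
  refine ContDiff.sum fun σ _ => ContDiff.const_smul _ ?_
  exact contDiff_prod fun i _ => hA _ _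

variable {n : ℕ} [NeZero n]

/-- The minor complementary to the upper left entry. -/
def minor (A : Matrix (Fin n) (Fin n) ℂ) : ℂ := (A.updateRow 0 (Pi.single 0 1)).det

/-- The matrix with prescribed entries off the upper left corner, and `0` there. -/
def base (e : SLModel n) : Matrix (Fin n) (Fin n) ℂ :=
  Matrix.of fun i j => if h : (i, j) ≠ ((0 : Fin n), (0 : Fin n)) then e ⟨(i, j), h⟩ else 0

/-- The matrix with prescribed entries off the upper left corner, whose upper left entry is
chosen so that its determinant is one (where the complementary minor does not vanish). -/
def solve (e : SLModel n) : Matrix (Fin n) (Fin n) ℂ :=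
  (base e).updateRow 0 (base e 0 + ((1 - (base e).det) / minor (base e)) • Pi.single 0 1)

theorem det_solve (e : SLModel n) (h : minor (base e) ≠ 0) : (solve e).det = 1 := by
  unfold solve
  rw [det_updateRow_add, det_updateRow_smul, updateRow_eq_self]
  change (base e).det + _ * minor (base e) = 1
  field_simp
  ring

open Classical in
/-- `solve` as a map to `SL_n(ℂ)`, with a junk value where the minor vanishes. -/
def fill (e : SLModel n) : SLn n :=
  if h : minor (base e) ≠ 0 then ⟨solve e, det_solve e h⟩ else 1

/-- The entries off the upper left corner. -/
def coords (g : SLn n) : SLModel n := fun q => g.1 q.1.1 q.1.2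

theorem fill_val (e : SLModel n) (h : minor (base e) ≠ 0) : (fill e).1 = solve e := by
  simp [fill, h]

theorem solve_apply (e : SLModel n) (i j : Fin n) :
    solve e i j = base e i j +
      if (i, j) = ((0 : Fin n), (0 : Fin n)) then (1 - (base e).det) / minor (base e) else 0 := by
  unfold solve
  by_cases hi : i = 0
  · subst hi
    by_cases hj : j = 0
    · subst hj; simp
    · simp [hj]
  · simp [hi]

theorem base_coords (g : SLn n) (i j : Fin n) :
    base (coords g) i j = g.1 i j - if (i, j) = ((0 : Fin n), (0 : Fin n)) then g.1 0 0 else 0 := by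
  by_cases h : (i, j) = ((0 : Fin n), (0 : Fin n))
  · obtain ⟨rfl, rfl⟩ := Prod.mk.inj h
    simp [base]
  · simp only [base, Matrix.of_apply, dif_pos h, if_neg h, coords, sub_zero]

theorem minor_congr {A B : Matrix (Fin n) (Fin n) ℂ} (h : ∀ i j, i ≠ 0 → A i j = B i j) :
    minor A = minor B := by
  unfold minor
  congr 1
  ext i j
  by_cases hi : i = 0
  · subst hi; simp
  · simp [hi, h i j hi]

theorem minor_base_coords (g : SLn n) : minor (base (coords g)) = minor g.1 :=
  minor_congr fun i j hi => by simp [base_coords, hi]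

theorem minor_solve (e : SLModel n) : minor (solve e) = minor (base e) :=
  minor_congr fun i j hi => by simp [solve_apply, hi]

theorem coords_fill (e : SLModel n) (h : minor (base e) ≠ 0) : coords (fill e) = e := by
  funext q
  obtain ⟨⟨i, j⟩, hq⟩ := q
  simp only [coords, fill_val e h, solve_apply, if_neg hq, add_zero, base, Matrix.of_apply,
    dif_pos hq]

theorem fill_coords (g : SLn n) (h : minor g.1 ≠ 0) : fill (coords g) = g := by
  have h' : minor (base (coords g)) ≠ 0 := by rwa [minor_base_coords]
  have key : g.1 = (base (coords g)).updateRow 0 (base (coords g) 0 + g.1 0 0 • Pi.single 0 1) := by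
    ext i j
    by_cases hi : i = 0
    · subst hi
      by_cases hj : j = 0
      · subst hj; simp [base_coords]
      · simp [base_coords, hj]
    · simp [base_coords, hi]
  have hd : (1 : ℂ) = (base (coords g)).det + g.1 0 0 * minor (base (coords g)) := by
    have := g.2
    rw [key, det_updateRow_add, det_updateRow_smul, updateRow_eq_self] at this
    exact this.symm
  apply Subtype.ext
  rw [fill_val _ h']
  ext i j
  rw [solve_apply, base_coords]
  by_cases hq : (i, j) = ((0 : Fin n), (0 : Fin n))
  · obtain ⟨rfl, rfl⟩ := Prod.mk.inj hq
    have : (1 - (base (coords g)).det) / minor (base (coords g)) = g.1 0 0 := by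
      rw [div_eq_iff h']; linear_combination hd
    simp [this]
  · simp [hq]

theorem minor_one : minor (1 : Matrix (Fin n) (Fin n) ℂ) = 1 := by
  have : (1 : Matrix (Fin n) (Fin n) ℂ).updateRow 0 (Pi.single 0 1) = 1 := by
    ext i j
    by_cases hi : i = 0
    · subst hi; simp [Matrix.one_apply, Pi.single_apply, eq_comm]
    · simp [hi]
  simp [minor, this]

theorem contDiff_base (i j : Fin n) : ContDiff ℂ ω fun e : SLModel n => base e i j := by
  unfold base
  by_cases h : (i, j) ≠ ((0 : Fin n), (0 : Fin n))
  · simp only [Matrix.of_apply, dif_pos h]; fun_prop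
  · simp only [Matrix.of_apply, dif_neg h]; fun_prop

theorem contDiff_minor_base : ContDiff ℂ ω fun e : SLModel n => minor (base e) := by
  refine contDiff_det fun i j => ?_
  by_cases hi : i = 0
  · subst hi; simp only [updateRow_self]; fun_prop
  · simp only [updateRow_ne hi]; exact contDiff_base i j

theorem contDiffOn_solve (i j : Fin n) :
    ContDiffOn ℂ ω (fun e : SLModel n => solve e i j) {e | minor (base e) ≠ 0} := by
  simp only [solve_apply]
  refine (contDiff_base i j).contDiffOn.add ?_
  split_ifs
  · exact (contDiff_const.sub (contDiff_det contDiff_base)).contDiffOn.div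
      contDiff_minor_base.contDiffOn fun e he => he
  · exact contDiffOn_const

theorem continuous_minor : Continuous fun g : SLn n => minor g.1 := by
  unfold minor
  refine Continuous.matrix_det ?_
  exact Continuous.matrix_updateRow _ continuous_subtype_val continuous_const

theorem continuous_coords : Continuous (coords : SLn n → SLModel n) := by
  refine continuous_pi fun q => ?_
  exact (continuous_subtype_val (p := fun A : Matrix (Fin n) (Fin n) ℂ => A.det = 1)).matrix_elem _ _

/-- The chart of `SL_n(ℂ)` around `h`: the entries of `h⁻¹ g` off the upper left corner. -/
def chart (h : SLn n) : OpenPartialHomeomorph (SLn n) (SLModel n) where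
  toFun g := coords (h⁻¹ * g)
  invFun e := h * fill e
  source := {g | minor (h⁻¹ * g).1 ≠ 0}
  target := {e | minor (base e) ≠ 0}
  map_source' g hg := by
    simpa only [mem_ofPred_eq, minor_base_coords] using hg
  map_target' e he := by
    rw [mem_ofPred_eq, inv_mul_cancel_left, fill_val e he, minor_solve]; exact he
  left_inv' g hg := by
    rw [fill_coords _ hg, mul_inv_cancel_left]
  right_inv' e he := by
    rw [inv_mul_cancel_left, coords_fill e he]
  open_source := isOpen_ne_fun (continuous_minor.comp (continuous_const_mul h⁻¹)) continuous_const
  open_target := isOpen_ne_fun contDiff_minor_base.continuous continuous_const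
  continuousOn_toFun := (continuous_coords.comp (continuous_const_mul h⁻¹)).continuousOn
  continuousOn_invFun := by
    refine (continuous_const_mul h).comp_continuousOn ?_
    rw [continuousOn_iff_continuous_domRestrict]
    refine Continuous.subtype_mk (f := fun e : {e : SLModel n | minor (base e) ≠ 0} =>
      (fill e.1).1) ?_ _
    refine continuous_matrix fun i j => ?_
    refine (continuousOn_iff_continuous_domRestrict.1 (contDiffOn_solve i j).continuousOn).congr ?_
    intro e
    simp [fill_val e.1 e.2]

instance : ChartedSpace (SLModel n) (SLn n) where
  atlas := range chart
  chartAt := chart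
  mem_chart_source h := by
    change minor (h⁻¹ * h).1 ≠ 0
    rw [inv_mul_cancel]
    exact (minor_one (n := n)).trans_ne one_ne_zero
  chart_mem_atlas h := mem_range_self h

instance : IsManifold 𝓘(ℂ, SLModel n) ω (SLn n) := by
  refine isManifold_of_contDiffOn _ _ _ ?_
  rintro _ _ ⟨h, rfl⟩ ⟨h', rfl⟩
  simp only [modelWithCornersSelf_coe, modelWithCornersSelf_coe_symm, Function.comp_def, id,
    range_id, inter_univ]
  rw [contDiffOn_pi]
  rintro ⟨⟨i, j⟩, hq⟩
  have h1 : ContDiffOn ℂ ω (fun e : SLModel n => ((h'⁻¹ * h).1 * solve e) i j)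
      {e | minor (base e) ≠ 0} := by
    simp only [Matrix.mul_apply]
    exact ContDiffOn.sum fun k _ => contDiffOn_const.mul (contDiffOn_solve k j)
  refine (h1.mono fun e he => he.1).congr fun e he => ?_
  have he' : minor (base e) ≠ 0 := he.1
  change (h'⁻¹ * (h * fill e)).1 i j = _
  rw [← mul_assoc, ← fill_val e he']
  rfl

theorem contMDiff_entry (i j : Fin n) :
    ContMDiff 𝓘(ℂ, SLModel n) 𝓘(ℂ) ω (fun g : SLn n => g.1 i j) := by
  intro h
  rw [contMDiffAt_iff_source]
  simp only [extChartAt, OpenPartialHomeomorph.extend, mfld_simps]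
  rw [contMDiffWithinAt_univ, contMDiffAt_iff_contDiffAt]
  change ContDiffAt ℂ ω (fun e => (h * fill e).1 i j) (coords (h⁻¹ * h))
  have hm : minor (base (coords (h⁻¹ * h))) ≠ 0 := by
    rw [minor_base_coords, inv_mul_cancel]; exact (minor_one (n := n)).trans_ne one_ne_zero
  have ho : {e : SLModel n | minor (base e) ≠ 0} ∈ 𝓝 (coords (h⁻¹ * h)) :=
    (isOpen_ne_fun contDiff_minor_base.continuous continuous_const).mem_nhds hm
  have h1 : ContDiffOn ℂ ω (fun e : SLModel n => (h.1 * solve e) i j)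
      {e | minor (base e) ≠ 0} := by
    simp only [Matrix.mul_apply]
    exact ContDiffOn.sum fun k _ => contDiffOn_const.mul (contDiffOn_solve k j)
  refine (h1.contDiffAt ho).congr_of_eventuallyEq ?_
  filter_upwards [ho] with e he
  rw [← fill_val e he]; rfl

/-- A map to `SL_n(ℂ)` is holomorphic if its matrix entries are. -/
theorem contMDiffOn_of_entries {F : Type*} [NormedAddCommGroup F] [NormedSpace ℂ F]
    {P : Type*} [TopologicalSpace P] [ChartedSpace F P] {f : P → SLn n} {s : Set P}
    (hf : ∀ i j, ContMDiffOn 𝓘(ℂ, F) 𝓘(ℂ) ω (fun p => (f p).1 i j) s) :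
    ContMDiffOn 𝓘(ℂ, F) 𝓘(ℂ, SLModel n) ω f s := by
  intro p hp
  have hc : ContinuousWithinAt f s p := by
    have : ContinuousOn f s := by
      rw [continuousOn_iff_continuous_domRestrict]
      exact Continuous.subtype_mk (continuous_matrix fun i j =>
        continuousOn_iff_continuous_domRestrict.1 (hf i j).continuousOn) _
    exact this p hp
  rw [contMDiffWithinAt_iff_target]
  refine ⟨hc, ?_⟩
  rw [contMDiffWithinAt_pi_space]
  intro q
  change ContMDiffWithinAt _ _ _ (fun x => (((f p)⁻¹).1 * (f x).1) q.1.1 q.1.2) s p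
  simp only [Matrix.mul_apply]
  refine ContMDiffWithinAt.sum fun k _ => ?_
  exact contMDiffWithinAt_const.mul (hf _ _ p hp)

/-- The tangent space of `SL_n(ℂ)` at the identity identified with a space of matrices, by the
differential of the inclusion of `SL_n(ℂ)` in the matrices (entry by entry). This is the usual
identification of the Lie algebra of `SL_n(ℂ)` with `𝔰𝔩_n(ℂ)`. -/
def lieMatrix (u : TangentSpace 𝓘(ℂ, SLModel n) (1 : SLn n)) : Matrix (Fin n) (Fin n) ℂ :=
  Matrix.of fun i j =>
    (mfderiv 𝓘(ℂ, SLModel n) 𝓘(ℂ) (fun g : SLn n => g.1 i j) 1 u : ℂ)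

end SLn

/-! ### Triangular subalgebras and subgroups -/

/-- `𝔟⁺`: the trace-free upper triangular matrices. -/
def bPlus (n : ℕ) : Submodule ℂ (Matrix (Fin n) (Fin n) ℂ) where
  carrier := {A | A.trace = 0 ∧ ∀ i j, j < i → A i j = 0}
  zero_mem' := by simp
  add_mem' := by
    rintro A B ⟨hA, hA'⟩ ⟨hB, hB'⟩
    refine ⟨by rw [trace_add, hA, hB, add_zero], fun i j h => ?_⟩
    rw [Matrix.add_apply, hA' i j h, hB' i j h, add_zero]
  smul_mem' := by
    rintro c A ⟨hA, hA'⟩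
    refine ⟨by rw [trace_smul, hA, smul_zero], fun i j h => ?_⟩
    rw [Matrix.smul_apply, hA' i j h, smul_zero]

/-- `𝔫⁻`: the strictly lower triangular matrices. -/
def nMinus (n : ℕ) : Submodule ℂ (Matrix (Fin n) (Fin n) ℂ) where
  carrier := {A | ∀ i j, i ≤ j → A i j = 0}
  zero_mem' := by simp
  add_mem' := by
    intro A B hA hB i j h
    rw [Matrix.add_apply, hA i j h, hB i j h, add_zero]
  smul_mem' := by
    intro c A hA i j h
    rw [Matrix.smul_apply, hA i j h, smul_zero]

/-- The projection onto the strictly lower triangular part; on `𝔰𝔩_n(ℂ) = 𝔟⁺ ⊕ 𝔫⁻` this is the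
projection onto `𝔫⁻` along `𝔟⁺ = 𝔥 ⊕ 𝔫⁺`. -/
def projMinus (n : ℕ) : Matrix (Fin n) (Fin n) ℂ →ₗ[ℂ] nMinus n where
  toFun A := ⟨Matrix.of fun i j => if j < i then A i j else 0, fun i j h => by
    simp [not_lt.2 h]⟩
  map_add' A B := by
    ext i j
    by_cases h : j < i <;> simp [h]
  map_smul' c A := by
    ext i j
    by_cases h : j < i <;> simp [h]

/-- `B⁺`: the upper triangular matrices of determinant one. -/
def BPlus (n : ℕ) : Subgroup (SLn n) where
  carrier := {g | ∀ i j, j < i → g.1 i j = 0}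
  one_mem' := fun i j h => by simp [h.ne']
  mul_mem' := by
    intro a b ha hb
    have := Matrix.BlockTriangular.mul (b := id) (M := a.1) (N := b.1)
      (fun i j h => ha i j h) (fun i j h => hb i j h)
    exact fun i j h => this h
  inv_mem' := by
    intro a ha
    have : Invertible a.1 := Matrix.invertibleOfIsUnitDet _ (by rw [a.2]; exact isUnit_one)
    have := Matrix.blockTriangular_inv_of_blockTriangular (b := id) (M := a.1)
      (fun i j h => ha i j h)
    intro i j h
    have h2 := this h
    rw [Matrix.inv_def, a.2] at h2
    simpa using h2

/-- The action of `B⁺` on `𝔫⁻ ≅ 𝔰𝔩_n(ℂ) / 𝔟⁺` induced by the adjoint action: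
`b · η = (b η b⁻¹)⁻`. -/
def adMinus {n : ℕ} (b : BPlus n) : nMinus n →ₗ[ℂ] nMinus n where
  toFun η := projMinus n (b.1.1 * η.1 * (b.1⁻¹ : SLn n).1)
  map_add' η ζ := by
    simp only [Submodule.coe_add, Matrix.mul_add, Matrix.add_mul, map_add]
  map_smul' c η := by
    simp only [Submodule.coe_smul, Matrix.mul_smul, Matrix.smul_mul, map_smul, RingHom.id_apply]

/-! ### The big cell of `SL_n(ℂ) / B⁺` -/

/-- Coordinates on the lower unipotent group `N⁻`: the entries below the diagonal. -/
abbrev LowModel (n : ℕ) : Type := {q : Fin n × Fin n // q.2 < q.1} → ℂ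

namespace SLn

section BigCell

variable {n : ℕ}

/-- The lower unipotent matrix with prescribed entries below the diagonal. -/
def lower (e : LowModel n) : SLn n :=
  ⟨Matrix.of fun i j => if h : j < i then e ⟨(i, j), h⟩ else if i = j then 1 else 0, by
    rw [Matrix.det_of_isLowerTriangular]
    · simp
    · intro i j h
      have h' : i < j := h
      simp [h'.not_gt, h'.ne]⟩

/-- The leading principal `j`-th block of `A`, extended by the identity. -/
def lead (j : Fin n) (A : Matrix (Fin n) (Fin n) ℂ) : Matrix (Fin n) (Fin n) ℂ :=
  Matrix.of fun i k => if i ≤ j ∧ k ≤ j then A i k else if i = k then 1 else 0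

/-- The big cell `N⁻ B⁺`: the matrices with nonvanishing leading principal minors. -/
def bigCell (n : ℕ) : Set (SLn n) := {g | ∀ j, (lead j g.1).det ≠ 0}

/-- The solution `c` of `lead j A * c = e_j`. -/
def leadSol (j : Fin n) (A : Matrix (Fin n) (Fin n) ℂ) (k : Fin n) : ℂ :=
  (lead j A).det⁻¹ * (lead j A).adjugate k j

/-- The entries of the lower unipotent factor `n₋` in the factorization `g = n₋ b₊` of an element
of the big cell. -/
def lowCoord (g : SLn n) : LowModel n := fun q => ∑ k, g.1 q.1.1 k * leadSol q.1.2 g.1 k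

theorem lead_mulVec_le {j : Fin n} {A : Matrix (Fin n) (Fin n) ℂ} {d : Fin n → ℂ}
    (hd : ∀ k, j < k → d k = 0) {i : Fin n} (hi : i ≤ j) :
    ∑ k, lead j A i k * d k = ∑ k, A i k * d k := by
  refine Finset.sum_congr rfl fun k _ => ?_
  by_cases hk : k ≤ j
  · simp [lead, hi, hk]
  · simp [hd k (not_le.1 hk)]

theorem lead_mulVec_gt {j : Fin n} {A : Matrix (Fin n) (Fin n) ℂ} {d : Fin n → ℂ}
    {i : Fin n} (hi : j < i) : ∑ k, lead j A i k * d k = d i := by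
  simp [lead, not_le.2 hi]

theorem lead_leadSol {j : Fin n} {A : Matrix (Fin n) (Fin n) ℂ} (hA : (lead j A).det ≠ 0)
    (i : Fin n) : ∑ k, lead j A i k * leadSol j A k = if i = j then 1 else 0 := by
  have h := congrFun (congrFun (Matrix.mul_adjugate (lead j A)) i) j
  rw [Matrix.mul_apply] at h
  calc ∑ k, lead j A i k * leadSol j A k
      = (lead j A).det⁻¹ * ∑ k, lead j A i k * (lead j A).adjugate k j := by
        rw [Finset.mul_sum]
        exact Finset.sum_congr rfl fun k _ => by unfold leadSol; ring
    _ = _ := by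
        rw [h, Matrix.smul_apply, Matrix.one_apply, smul_eq_mul, ← mul_assoc,
          inv_mul_cancel₀ hA, one_mul]

theorem leadSol_eq_zero {j : Fin n} {A : Matrix (Fin n) (Fin n) ℂ} (hA : (lead j A).det ≠ 0)
    {k : Fin n} (hk : j < k) : leadSol j A k = 0 := by
  have := lead_leadSol hA k
  rwa [lead_mulVec_gt hk, if_neg hk.ne'] at this

theorem mul_leadSol {j : Fin n} {A : Matrix (Fin n) (Fin n) ℂ} (hA : (lead j A).det ≠ 0)
    {i : Fin n} (hi : i ≤ j) : ∑ k, A i k * leadSol j A k = if i = j then 1 else 0 := by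
  rw [← lead_mulVec_le (fun k hk => leadSol_eq_zero hA hk) hi, lead_leadSol hA]

theorem leadSol_unique {j : Fin n} {A : Matrix (Fin n) (Fin n) ℂ} (hA : (lead j A).det ≠ 0)
    {d : Fin n → ℂ} (hd : ∀ k, j < k → d k = 0)
    (h : ∀ i, i ≤ j → ∑ k, A i k * d k = if i = j then 1 else 0) : leadSol j A = d := by
  have h1 : lead j A *ᵥ leadSol j A = lead j A *ᵥ d := by
    funext i
    change ∑ k, lead j A i k * leadSol j A k = ∑ k, lead j A i k * d k
    rw [lead_leadSol hA]
    rcases le_or_gt i j with hi | hi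
    · rw [lead_mulVec_le hd hi, h i hi]
    · rw [lead_mulVec_gt hi, hd i hi, if_neg hi.ne']
  exact Matrix.mulVec_injective_of_isUnit
    ((Matrix.isUnit_iff_isUnit_det _).2 (isUnit_iff_ne_zero.2 hA)) h1

theorem lead_mul {j : Fin n} (A : Matrix (Fin n) (Fin n) ℂ) {B : Matrix (Fin n) (Fin n) ℂ}
    (hB : ∀ i k, k < i → B i k = 0) : lead j (A * B) = lead j A * lead j B := by
  ext i k
  rw [Matrix.mul_apply]
  by_cases hk : k ≤ j
  · have hs : ∀ l, j < l → lead j B l k = 0 := fun l hl => by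
      simp [lead, not_le.2 hl, (hk.trans_lt hl).ne']
    rcases le_or_gt i j with hi | hi
    · rw [lead_mulVec_le hs hi]
      simp only [lead, Matrix.of_apply, hi, hk, and_self, if_true, Matrix.mul_apply]
      refine Finset.sum_congr rfl fun l _ => ?_
      by_cases hl : l ≤ j
      · simp [hl]
      · have hl := not_le.1 hl
        simp [hl.not_ge, hB l k (hk.trans_lt hl), (hk.trans_lt hl).ne']
    · rw [lead_mulVec_gt hi, hs i hi]
      simp [lead, hi.not_ge, (hk.trans_lt hi).ne']
  · have h1 : ∀ (M : Matrix (Fin n) (Fin n) ℂ) l, lead j M l k = if l = k then 1 else 0 :=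
      fun M l => by simp [lead, hk]
    simp only [h1, mul_ite, mul_one, mul_zero, Finset.sum_ite_eq', Finset.mem_univ, if_true]

theorem det_lead_BPlus (j : Fin n) {b : SLn n} (hb : b ∈ BPlus n) : (lead j b.1).det ≠ 0 := by
  have h1 : ∀ i, b.1 i i ≠ 0 := by
    have hd : b.1.det = ∏ i, b.1 i i := Matrix.det_of_isUpperTriangular fun i k h => hb i k h
    rw [b.2] at hd
    intro i hi
    exact one_ne_zero (hd.trans (Finset.prod_eq_zero (Finset.mem_univ i) hi))
  rw [Matrix.det_of_isUpperTriangular]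
  · refine Finset.prod_ne_zero_iff.2 fun i _ => ?_
    by_cases hi : i ≤ j <;> simp [lead, hi, h1]
  · intro i k h
    have h' : k < i := h
    simp [lead, hb i k h', h'.ne']

theorem mul_mem_bigCell {g b : SLn n} (hg : g ∈ bigCell n) (hb : b ∈ BPlus n) :
    g * b ∈ bigCell n := by
  intro j
  change (lead j (g.1 * b.1)).det ≠ 0
  rw [lead_mul _ hb, Matrix.det_mul]
  exact mul_ne_zero (hg j) (det_lead_BPlus j hb)

theorem lowCoord_mul {g b : SLn n} (hg : g ∈ bigCell n) (hb : b ∈ BPlus n) :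
    lowCoord (g * b) = lowCoord g := by
  funext q
  obtain ⟨⟨i, j⟩, hq⟩ := q
  have hb' := (BPlus n).inv_mem hb
  have key : (g * b).1 *ᵥ ((b⁻¹).1 *ᵥ leadSol j g.1) = g.1 *ᵥ leadSol j g.1 := by
    rw [Matrix.mulVec_mulVec]
    congr 1
    exact congrArg Subtype.val (mul_inv_cancel_right g b)
  have hu : leadSol j (g * b).1 = (b⁻¹).1 *ᵥ leadSol j g.1 := by
    refine leadSol_unique (mul_mem_bigCell hg hb j) (fun k hk => ?_) fun i hi => ?_
    · change ∑ l, (b⁻¹).1 k l * leadSol j g.1 l = 0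
      refine Finset.sum_eq_zero fun l _ => ?_
      rcases le_or_gt l j with hl | hl
      · rw [hb' k l (hl.trans_lt hk), zero_mul]
      · rw [leadSol_eq_zero (hg j) hl, mul_zero]
    · exact (congrFun key i).trans (mul_leadSol (hg j) hi)
  change ((g * b).1 *ᵥ leadSol j (g * b).1) i = (g.1 *ᵥ leadSol j g.1) i
  rw [hu, key]

theorem lower_mem_bigCell (e : LowModel n) : lower e ∈ bigCell n := by
  intro j
  rw [Matrix.det_of_isLowerTriangular]
  · simp [lead, lower]
  · intro i k h
    have h' : i < k := h
    simp [lead, lower, h'.not_gt, h'.ne]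

theorem lowCoord_lower (e : LowModel n) : lowCoord (lower e) = e := by
  funext q
  obtain ⟨⟨i, j⟩, hq⟩ := q
  have hu : leadSol j (lower e).1 = Pi.single j 1 := by
    refine leadSol_unique (lower_mem_bigCell e j) (fun k hk => ?_) fun i hi => ?_
    · simp [hk.ne']
    · simp [Pi.single_apply, lower, hi.not_gt]
  have hq' : j < i := hq
  change ∑ k, (lower e).1 i k * leadSol j (lower e).1 k = _
  rw [hu]
  simp [Pi.single_apply, lower, hq']

theorem exists_lower_eq {g : SLn n} (hg : g ∈ bigCell n) :
    ∃ b ∈ BPlus n, lower (lowCoord g) = g * b := by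
  refine ⟨g⁻¹ * lower (lowCoord g), ?_, (mul_inv_cancel_left _ _).symm⟩
  have h1 : (lower (lowCoord g)).1 = g.1 * Matrix.of fun k j => leadSol j g.1 k := by
    ext i j
    rw [Matrix.mul_apply]
    rcases lt_or_ge j i with hij | hij
    · simp [lower, hij, lowCoord]
    · simp only [Matrix.of_apply]
      rw [mul_leadSol (hg j) hij]
      simp [lower, hij.not_gt]
  have h2 : (g⁻¹ * lower (lowCoord g)).1 = Matrix.of fun k j => leadSol j g.1 k := by
    change (g⁻¹).1 * (lower (lowCoord g)).1 = _
    rw [h1, ← Matrix.mul_assoc]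
    have : (g⁻¹).1 * g.1 = 1 := congrArg Subtype.val (inv_mul_cancel g)
    rw [this, Matrix.one_mul]
  intro k j hjk
  rw [h2]
  exact leadSol_eq_zero (hg j) hjk

theorem isOpen_bigCell : IsOpen (bigCell n) := by
  simp only [bigCell, ofPred_forall]
  refine isOpen_iInter_of_finite fun j => isOpen_ne_fun ?_ continuous_const
  refine Continuous.matrix_det (continuous_matrix fun i k => ?_)
  by_cases h : i ≤ j ∧ k ≤ j
  · simp only [lead, Matrix.of_apply, if_pos h]
    exact (continuous_subtype_val
      (p := fun A : Matrix (Fin n) (Fin n) ℂ => A.det = 1)).matrix_elem _ _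
  · simp only [lead, Matrix.of_apply, if_neg h]
    exact continuous_const

end BigCell

theorem contMDiffOn_det {n : ℕ} {F : Type*} [NormedAddCommGroup F] [NormedSpace ℂ F]
    {P : Type*} [TopologicalSpace P] [ChartedSpace F P]
    {f : P → Matrix (Fin n) (Fin n) ℂ} {s : Set P}
    (hf : ∀ i j, ContMDiffOn 𝓘(ℂ, F) 𝓘(ℂ) ω (fun p => f p i j) s) :
    ContMDiffOn 𝓘(ℂ, F) 𝓘(ℂ) ω (fun p => (f p).det) s := by
  simp only [Matrix.det_apply']
  refine contMDiffOn_finsetSum fun σ _ => ?_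
  exact contMDiffOn_const.mul (contMDiffOn_finsetProd fun i _ => hf _ _)

variable {n : ℕ} [NeZero n]

theorem contMDiffOn_lowCoord :
    ContMDiffOn 𝓘(ℂ, SLModel n) 𝓘(ℂ, LowModel n) ω (lowCoord : SLn n → LowModel n)
      (bigCell n) := by
  rw [contMDiffOn_pi_space]
  rintro ⟨⟨i, j⟩, hq⟩
  have hl : ∀ a b, ContMDiffOn 𝓘(ℂ, SLModel n) 𝓘(ℂ) ω (fun g : SLn n => lead j g.1 a b)
      (bigCell n) := by
    intro a b
    by_cases h : a ≤ j ∧ b ≤ j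
    · simp only [lead, Matrix.of_apply, if_pos h]; exact (contMDiff_entry a b).contMDiffOn
    · simp only [lead, Matrix.of_apply, if_neg h]; exact contMDiffOn_const
  change ContMDiffOn _ _ _ (fun g : SLn n => ∑ k, g.1 i k * leadSol j g.1 k) _
  refine contMDiffOn_finsetSum fun k _ => (contMDiff_entry i k).contMDiffOn.mul ?_
  unfold leadSol
  refine ContMDiffOn.mul ((contMDiffOn_det hl).inv₀ fun g hg => hg j) ?_
  simp only [Matrix.adjugate_apply]
  refine contMDiffOn_det fun a b => ?_
  by_cases ha : a = j
  · subst ha; simp only [updateRow_self]; exact contMDiffOn_const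
  · simp only [updateRow_ne ha]; exact hl a b

theorem contMDiff_mul_lower (h : SLn n) :
    ContMDiff 𝓘(ℂ, LowModel n) 𝓘(ℂ, SLModel n) ω fun e : LowModel n => h * lower e := by
  rw [← contMDiffOn_univ]
  refine contMDiffOn_of_entries fun i j => ?_
  change ContMDiffOn _ _ _ (fun e : LowModel n => (h.1 * (lower e).1) i j) _
  simp only [Matrix.mul_apply]
  refine contMDiffOn_finsetSum fun k _ => contMDiffOn_const.mul ?_
  rw [contMDiffOn_univ, contMDiff_iff_contDiff]
  by_cases hk : j < k
  · simp only [lower, Matrix.of_apply, dif_pos hk]; fun_prop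
  · simp only [lower, Matrix.of_apply, dif_neg hk]; exact contDiff_const

theorem contMDiff_mul_left (h : SLn n) :
    ContMDiff 𝓘(ℂ, SLModel n) 𝓘(ℂ, SLModel n) ω fun g : SLn n => h * g := by
  rw [← contMDiffOn_univ]
  refine contMDiffOn_of_entries fun i j => ?_
  change ContMDiffOn _ _ _ (fun g : SLn n => (h.1 * g.1) i j) _
  simp only [Matrix.mul_apply]
  exact contMDiffOn_finsetSum fun k _ => contMDiffOn_const.mul (contMDiff_entry k j).contMDiffOn

end SLn

/-! ### Holomorphic principal `SL_n(ℂ)`-bundles and their connections -/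

section Bundle

variable {F : Type*} [NormedAddCommGroup F] [NormedSpace ℂ F]

/-- `ρ : P → C` is a holomorphic principal `SL_n(ℂ)`-bundle (with right action `p <• g`) over the
one-dimensional complex manifold `C`. -/
structure IsHolomorphicPrincipalBundle (n : ℕ) [NeZero n] (F : Type*) [NormedAddCommGroup F]
    [NormedSpace ℂ F] {C : Type*} [TopologicalSpace C] [ChartedSpace ℂ C]
    {P : Type*} [TopologicalSpace P] [ChartedSpace F P] [MulAction (SLn n)ᵐᵒᵖ P]
    (ρ : P → C) : Prop where
  contMDiff_action : ContMDiff (𝓘(ℂ, F).prod 𝓘(ℂ, SLModel n)) 𝓘(ℂ, F) ω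
    fun x : P × SLn n => x.1 <• x.2
  proj_action : ∀ (p : P) (g : SLn n), ρ (p <• g) = ρ p
  exists_trivialization : ∀ x : C, ∃ (U : Set C) (φ : OpenPartialHomeomorph P (C × SLn n)),
    IsOpen U ∧ x ∈ U ∧ φ.source = ρ ⁻¹' U ∧ φ.target = U ×ˢ univ ∧
    ContMDiffOn 𝓘(ℂ, F) (𝓘(ℂ).prod 𝓘(ℂ, SLModel n)) ω φ φ.source ∧
    ContMDiffOn (𝓘(ℂ).prod 𝓘(ℂ, SLModel n)) 𝓘(ℂ, F) ω φ.symm φ.target ∧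
    ∀ p ∈ φ.source, (φ p).1 = ρ p ∧ ∀ g : SLn n, (φ (p <• g)).2 = (φ p).2 * g

/-- The fundamental vector field of the element `u` of the Lie algebra `T₁ SL_n(ℂ)`, at the point
`p = p <• 1`: the differential at `1` of the orbit map `g ↦ p <• g`, applied to `u`. -/
def fundamentalField {n : ℕ} [NeZero n] (F : Type*) [NormedAddCommGroup F] [NormedSpace ℂ F]
    {P : Type*} [TopologicalSpace P] [ChartedSpace F P] [MulAction (SLn n)ᵐᵒᵖ P] (p : P)
    (u : TangentSpace 𝓘(ℂ, SLModel n) (1 : SLn n)) :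
    TangentSpace 𝓘(ℂ, F) (p <• (1 : SLn n)) :=
  mfderiv 𝓘(ℂ, SLModel n) 𝓘(ℂ, F) (fun g : SLn n => p <• g) 1 u

/-- A holomorphic connection on a principal `SL_n(ℂ)`-bundle with total space `P`, given by its
connection form: a holomorphic `𝔰𝔩_n(ℂ)`-valued 1-form on `P` which reproduces the generators of
the fundamental vector fields and satisfies `R_g^* ω = Ad(g⁻¹) ω`. -/
structure HolomorphicConnection (n : ℕ) [NeZero n] (F : Type*) [NormedAddCommGroup F]
    [NormedSpace ℂ F] (P : Type*) [TopologicalSpace P] [ChartedSpace F P]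
    [IsManifold 𝓘(ℂ, F) ω P] [MulAction (SLn n)ᵐᵒᵖ P] where
  form : ∀ p : P, TangentSpace 𝓘(ℂ, F) p →ₗ[ℂ] sln n
  holomorphic : ∀ i j : Fin n, ContMDiff 𝓘(ℂ, F).tangent 𝓘(ℂ) ω
    fun v : TangentBundle 𝓘(ℂ, F) P => (form v.proj v.snd).1 i j
  form_fundamentalField : ∀ (p : P) (u : TangentSpace 𝓘(ℂ, SLModel n) (1 : SLn n)),
    (form _ (fundamentalField F p u)).1 = SLn.lieMatrix u
  form_action : ∀ (g : SLn n) (p : P) (v : TangentSpace 𝓘(ℂ, F) p),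
    (form (p <• g) (mfderiv 𝓘(ℂ, F) 𝓘(ℂ, F) (fun q : P => q <• g) p v)).1 =
      (g⁻¹).1 * (form p v).1 * g.1

namespace HolomorphicConnection

variable {n : ℕ} [NeZero n] {P : Type*} [TopologicalSpace P] [ChartedSpace F P]
  [IsManifold 𝓘(ℂ, F) ω P] [MulAction (SLn n)ᵐᵒᵖ P]

/-- The `𝔫⁻`-component `ω⁻` of the connection form. -/
def minus (A : HolomorphicConnection n F P) (p : P) : TangentSpace 𝓘(ℂ, F) p →ₗ[ℂ] nMinus n :=
  projMinus n ∘ₗ (sln n).subtype ∘ₗ A.form p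

/-- The horizontal distribution `H ⊆ TP` of the connection. -/
def horizontal (A : HolomorphicConnection n F P) : Set (TangentBundle 𝓘(ℂ, F) P) :=
  {v | A.form v.proj v.snd = 0}

end HolomorphicConnection

end Bundle

/-! ### The flag bundle `X = P / B⁺` -/

section Flag

variable {n : ℕ} [NeZero n]
  {C : Type*} [TopologicalSpace C] [ChartedSpace ℂ C]
  {F : Type*} [NormedAddCommGroup F] [NormedSpace ℂ F]
  {P : Type*} [TopologicalSpace P] [ChartedSpace F P]
  [MulAction (SLn n)ᵐᵒᵖ P] {ρ : P → C}

/-- The orbit space `X = P / B⁺` of a holomorphic principal `SL_n(ℂ)`-bundle `ρ : P → C`. -/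
def FlagBundle {n : ℕ} [NeZero n] {C : Type*} [TopologicalSpace C] [ChartedSpace ℂ C]
    {F : Type*} [NormedAddCommGroup F] [NormedSpace ℂ F]
    {P : Type*} [TopologicalSpace P] [ChartedSpace F P] [MulAction (SLn n)ᵐᵒᵖ P] {ρ : P → C}
    (_hρ : IsHolomorphicPrincipalBundle n F ρ) : Type _ :=
  Quotient (MulAction.orbitRel (BPlus n).op P)

/-- The model space of `X`: a coordinate on the base and the coordinates of the big cell. -/
abbrev FlagModel (n : ℕ) : Type := ℂ × LowModel n

namespace FlagBundle

instance (hρ : IsHolomorphicPrincipalBundle n F ρ) : TopologicalSpace (FlagBundle hρ) :=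
  inferInstanceAs (TopologicalSpace (Quotient (MulAction.orbitRel (BPlus n).op P)))

/-- The projection `P → X = P / B⁺`. -/
def proj (hρ : IsHolomorphicPrincipalBundle n F ρ) (p : P) : FlagBundle hρ :=
  Quotient.mk (MulAction.orbitRel (BPlus n).op P) p

variable (hρ : IsHolomorphicPrincipalBundle n F ρ)

/-- An open set of `C` around `ρ p₀` over which `P` is trivial. -/
def trivBase (p₀ : P) : Set C := (hρ.exists_trivialization (ρ p₀)).choose

/-- A local trivialization of `P` around `p₀`. -/
def triv (p₀ : P) : OpenPartialHomeomorph P (C × SLn n) :=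
  (hρ.exists_trivialization (ρ p₀)).choose_spec.choose

theorem triv_spec (p₀ : P) : IsOpen (trivBase hρ p₀) ∧ ρ p₀ ∈ trivBase hρ p₀ ∧
    (triv hρ p₀).source = ρ ⁻¹' trivBase hρ p₀ ∧
    (triv hρ p₀).target = trivBase hρ p₀ ×ˢ univ ∧
    ContMDiffOn 𝓘(ℂ, F) (𝓘(ℂ).prod 𝓘(ℂ, SLModel n)) ω (triv hρ p₀) (triv hρ p₀).source ∧
    ContMDiffOn (𝓘(ℂ).prod 𝓘(ℂ, SLModel n)) 𝓘(ℂ, F) ω (triv hρ p₀).symm (triv hρ p₀).target ∧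
    ∀ p ∈ (triv hρ p₀).source, (triv hρ p₀ p).1 = ρ p ∧
      ∀ g : SLn n, (triv hρ p₀ (p <• g)).2 = (triv hρ p₀ p).2 * g :=
  (hρ.exists_trivialization (ρ p₀)).choose_spec.choose_spec

/-- The matrix of `p` in the local trivialization around `p₀`, normalized to be `1` at `p₀`. -/
def frame (p₀ p : P) : SLn n := (triv hρ p₀ p₀).2⁻¹ * (triv hρ p₀ p).2

/-- The `B⁺`-invariant open set of `P` over which a chart of `X` is defined. -/
def cell (p₀ : P) : Set P :=
  (triv hρ p₀).source ∩ {p | ρ p ∈ (chartAt ℂ (ρ p₀)).source ∧ frame hρ p₀ p ∈ SLn.bigCell n}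

/-- The coordinates `(z, n₋)` of the class of `p` in `X`. -/
def flagCoord (p₀ p : P) : FlagModel n :=
  (chartAt ℂ (ρ p₀) (ρ p), SLn.lowCoord (frame hρ p₀ p))

/-- The set of values of the coordinates `(z, n₋)`. -/
def cellTarget (p₀ : P) : Set (FlagModel n) :=
  {y | y.1 ∈ (chartAt ℂ (ρ p₀)).target ∧ (chartAt ℂ (ρ p₀)).symm y.1 ∈ trivBase hρ p₀}

/-- The point of `P` with base coordinate `z` and lower unipotent matrix `n₋`. -/
def cellSection (p₀ : P) (y : FlagModel n) : P :=
  (triv hρ p₀).symm ((chartAt ℂ (ρ p₀)).symm y.1, (triv hρ p₀ p₀).2 * SLn.lower y.2)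

theorem proj_eq_iff {p q : P} : proj hρ p = proj hρ q ↔ ∃ b ∈ BPlus n, p = q <• b := by
  constructor
  · intro h
    obtain ⟨b, hb⟩ := (Quotient.exact h : MulAction.orbitRel (BPlus n).op P p q)
    exact ⟨b.1.unop, b.2, hb.symm⟩
  · rintro ⟨b, hb, rfl⟩
    exact Quotient.sound ⟨⟨MulOpposite.op b, hb⟩, rfl⟩

theorem proj_action (p : P) (b : BPlus n) : proj hρ (p <• b.1) = proj hρ p :=
  (proj_eq_iff hρ).2 ⟨b.1, b.2, rfl⟩

theorem frame_action {p₀ p : P} (hp : p ∈ (triv hρ p₀).source) (g : SLn n) :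
    frame hρ p₀ (p <• g) = frame hρ p₀ p * g := by
  unfold frame
  rw [((triv_spec hρ p₀).2.2.2.2.2.2 p hp).2, mul_assoc]

theorem action_mem_source {p₀ p : P} (hp : p ∈ (triv hρ p₀).source) (g : SLn n) :
    p <• g ∈ (triv hρ p₀).source := by
  rw [(triv_spec hρ p₀).2.2.1] at hp ⊢
  change ρ (p <• g) ∈ trivBase hρ p₀
  rw [hρ.proj_action]
  exact hp

theorem action_mem_cell {p₀ p : P} (hp : p ∈ cell hρ p₀) {b : SLn n} (hb : b ∈ BPlus n) :
    p <• b ∈ cell hρ p₀ := by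
  refine ⟨action_mem_source hρ hp.1 b, ?_, ?_⟩
  · rw [hρ.proj_action]; exact hp.2.1
  · rw [frame_action hρ hp.1]; exact SLn.mul_mem_bigCell hp.2.2 hb

theorem flagCoord_action {p₀ p : P} (hp : p ∈ cell hρ p₀) {b : SLn n} (hb : b ∈ BPlus n) :
    flagCoord hρ p₀ (p <• b) = flagCoord hρ p₀ p := by
  unfold flagCoord
  rw [hρ.proj_action, frame_action hρ hp.1, SLn.lowCoord_mul hp.2.2 hb]

theorem cellSection_mem_target {p₀ : P} {y : FlagModel n} (hy : y ∈ cellTarget hρ p₀) :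
    ((chartAt ℂ (ρ p₀)).symm y.1, (triv hρ p₀ p₀).2 * SLn.lower y.2) ∈
      (triv hρ p₀).target := by
  rw [(triv_spec hρ p₀).2.2.2.1]
  exact ⟨hy.2, mem_univ _⟩

theorem cellSection_mem_source {p₀ : P} {y : FlagModel n} (hy : y ∈ cellTarget hρ p₀) :
    cellSection hρ p₀ y ∈ (triv hρ p₀).source :=
  (triv hρ p₀).map_target (cellSection_mem_target hρ hy)

theorem triv_cellSection {p₀ : P} {y : FlagModel n} (hy : y ∈ cellTarget hρ p₀) :
    triv hρ p₀ (cellSection hρ p₀ y) =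
      ((chartAt ℂ (ρ p₀)).symm y.1, (triv hρ p₀ p₀).2 * SLn.lower y.2) :=
  (triv hρ p₀).right_inv (cellSection_mem_target hρ hy)

theorem base_cellSection {p₀ : P} {y : FlagModel n} (hy : y ∈ cellTarget hρ p₀) :
    ρ (cellSection hρ p₀ y) = (chartAt ℂ (ρ p₀)).symm y.1 := by
  rw [← ((triv_spec hρ p₀).2.2.2.2.2.2 _ (cellSection_mem_source hρ hy)).1,
    triv_cellSection hρ hy]

theorem frame_cellSection {p₀ : P} {y : FlagModel n} (hy : y ∈ cellTarget hρ p₀) :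
    frame hρ p₀ (cellSection hρ p₀ y) = SLn.lower y.2 := by
  unfold frame
  rw [triv_cellSection hρ hy, inv_mul_cancel_left]

theorem cellSection_mem_cell {p₀ : P} {y : FlagModel n} (hy : y ∈ cellTarget hρ p₀) :
    cellSection hρ p₀ y ∈ cell hρ p₀ := by
  refine ⟨cellSection_mem_source hρ hy, ?_, ?_⟩
  · rw [base_cellSection hρ hy]; exact (chartAt ℂ (ρ p₀)).map_target hy.1
  · rw [frame_cellSection hρ hy]; exact SLn.lower_mem_bigCell _

theorem flagCoord_cellSection {p₀ : P} {y : FlagModel n} (hy : y ∈ cellTarget hρ p₀) :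
    flagCoord hρ p₀ (cellSection hρ p₀ y) = y := by
  unfold flagCoord
  rw [base_cellSection hρ hy, frame_cellSection hρ hy, SLn.lowCoord_lower,
    (chartAt ℂ (ρ p₀)).right_inv hy.1]

theorem flagCoord_mem_target {p₀ p : P} (hp : p ∈ cell hρ p₀) :
    flagCoord hρ p₀ p ∈ cellTarget hρ p₀ := by
  refine ⟨(chartAt ℂ (ρ p₀)).map_source hp.2.1, ?_⟩
  change (chartAt ℂ (ρ p₀)).symm (chartAt ℂ (ρ p₀) (ρ p)) ∈ _
  rw [(chartAt ℂ (ρ p₀)).left_inv hp.2.1]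
  have := hp.1
  rwa [(triv_spec hρ p₀).2.2.1] at this

theorem proj_cellSection_flagCoord {p₀ p : P} (hp : p ∈ cell hρ p₀) :
    proj hρ (cellSection hρ p₀ (flagCoord hρ p₀ p)) = proj hρ p := by
  obtain ⟨b, hb, hlow⟩ := SLn.exists_lower_eq hp.2.2
  rw [proj_eq_iff]
  refine ⟨b, hb, ?_⟩
  refine (triv hρ p₀).injOn (cellSection_mem_source hρ (flagCoord_mem_target hρ hp))
    (action_mem_source hρ hp.1 b) ?_
  have hs := (triv_spec hρ p₀).2.2.2.2.2.2
  rw [triv_cellSection hρ (flagCoord_mem_target hρ hp)]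
  refine Prod.ext ?_ ?_
  · rw [(hs _ (action_mem_source hρ hp.1 b)).1, hρ.proj_action]
    exact (chartAt ℂ (ρ p₀)).left_inv hp.2.1
  · change (triv hρ p₀ p₀).2 * SLn.lower (SLn.lowCoord (frame hρ p₀ p)) = _
    rw [hlow, (hs p hp.1).2, frame]
    group

theorem contMDiffOn_base (p₀ : P) : ContMDiffOn 𝓘(ℂ, F) 𝓘(ℂ) ω ρ (triv hρ p₀).source :=
  ((contMDiff_fst.comp_contMDiffOn (triv_spec hρ p₀).2.2.2.2.1)).congr fun p hp =>
    ((triv_spec hρ p₀).2.2.2.2.2.2 p hp).1.symm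

theorem contMDiffOn_frame (p₀ : P) :
    ContMDiffOn 𝓘(ℂ, F) 𝓘(ℂ, SLModel n) ω (frame hρ p₀) (triv hρ p₀).source :=
  (SLn.contMDiff_mul_left _).comp_contMDiffOn
    (contMDiff_snd.comp_contMDiffOn (triv_spec hρ p₀).2.2.2.2.1)

theorem isOpen_cell (p₀ : P) : IsOpen (cell hρ p₀) := by
  have h1 := (contMDiffOn_base hρ p₀).continuousOn.isOpen_inter_preimage
    (triv hρ p₀).open_source (chartAt ℂ (ρ p₀)).open_source
  have h2 := (contMDiffOn_frame hρ p₀).continuousOn.isOpen_inter_preimage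
    (triv hρ p₀).open_source (SLn.isOpen_bigCell (n := n))
  convert! h1.inter h2 using 1
  ext p
  exact ⟨fun h => ⟨⟨h.1, h.2.1⟩, h.1, h.2.2⟩, fun h => ⟨h.1.1, h.1.2, h.2.2⟩⟩

theorem isOpen_cellTarget (p₀ : P) : IsOpen (cellTarget hρ p₀) := by
  have := (chartAt ℂ (ρ p₀)).symm.continuousOn.isOpen_inter_preimage
    (chartAt ℂ (ρ p₀)).open_target (triv_spec hρ p₀).1
  exact this.preimage continuous_fst

theorem preimage_proj_image_cell (p₀ : P) : proj hρ ⁻¹' (proj hρ '' cell hρ p₀) = cell hρ p₀ := by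
  refine Subset.antisymm ?_ (subset_preimage_image _ _)
  rintro p ⟨q, hq, hqp⟩
  obtain ⟨b, hb, rfl⟩ := (proj_eq_iff hρ).1 hqp.symm
  exact action_mem_cell hρ hq hb

theorem flagCoord_out {p₀ p : P} (hp : p ∈ cell hρ p₀) :
    flagCoord hρ p₀ (Quotient.out (proj hρ p)) = flagCoord hρ p₀ p := by
  have h : proj hρ (Quotient.out (proj hρ p)) = proj hρ p := Quotient.out_eq _
  obtain ⟨b, hb, h2⟩ := (proj_eq_iff hρ).1 h
  rw [h2, flagCoord_action hρ hp hb]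

theorem continuous_proj : Continuous (proj hρ) := continuous_quot_mk

theorem mem_cell (p₀ : P) : p₀ ∈ cell hρ p₀ := by
  refine ⟨?_, mem_chart_source ℂ (ρ p₀), ?_⟩
  · rw [(triv_spec hρ p₀).2.2.1]; exact (triv_spec hρ p₀).2.1
  · intro j
    have h1 : SLn.lead j (frame hρ p₀ p₀).1 = 1 := by
      have : frame hρ p₀ p₀ = 1 := inv_mul_cancel _
      rw [this]
      ext i k
      simp [SLn.lead, Matrix.one_apply]
    rw [h1, Matrix.det_one]
    exact one_ne_zero

variable [IsManifold 𝓘(ℂ) ω C]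

theorem contMDiffOn_flagCoord (p₀ : P) :
    ContMDiffOn 𝓘(ℂ, F) 𝓘(ℂ, FlagModel n) ω (flagCoord hρ p₀) (cell hρ p₀) := by
  refine ContMDiffOn.prodMk_space ?_ ?_
  · exact contMDiffOn_chart.comp ((contMDiffOn_base hρ p₀).mono fun p hp => hp.1)
      fun p hp => hp.2.1
  · exact SLn.contMDiffOn_lowCoord.comp ((contMDiffOn_frame hρ p₀).mono fun p hp => hp.1)
      fun p hp => hp.2.2

theorem contMDiffOn_cellSection (p₀ : P) :
    ContMDiffOn 𝓘(ℂ, FlagModel n) 𝓘(ℂ, F) ω (cellSection hρ p₀) (cellTarget hρ p₀) := by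
  refine ContMDiffOn.comp (triv_spec hρ p₀).2.2.2.2.2.1 ?_
    fun y hy => cellSection_mem_target hρ hy
  refine ContMDiffOn.prodMk ?_ ?_
  · exact contMDiffOn_chart_symm.comp contDiff_fst.contMDiff.contMDiffOn fun y hy => hy.1
  · exact ((SLn.contMDiff_mul_lower _).comp contDiff_snd.contMDiff).contMDiffOn

/-- The chart of `X` around the class of `p₀`, with coordinates `(z, n₋)`. -/
def chart (p₀ : P) : OpenPartialHomeomorph (FlagBundle hρ) (FlagModel n) where
  toFun x := flagCoord hρ p₀ (Quotient.out x)
  invFun y := proj hρ (cellSection hρ p₀ y)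
  source := proj hρ '' cell hρ p₀
  target := cellTarget hρ p₀
  map_source' := by
    rintro _ ⟨p, hp, rfl⟩
    rw [flagCoord_out hρ hp]
    exact flagCoord_mem_target hρ hp
  map_target' y hy := mem_image_of_mem _ (cellSection_mem_cell hρ hy)
  left_inv' := by
    rintro _ ⟨p, hp, rfl⟩
    rw [flagCoord_out hρ hp, proj_cellSection_flagCoord hρ hp]
  right_inv' y hy := by
    rw [flagCoord_out hρ (cellSection_mem_cell hρ hy), flagCoord_cellSection hρ hy]
  open_source := by
    refine isOpen_coinduced.2 ?_
    change IsOpen (proj hρ ⁻¹' (proj hρ '' cell hρ p₀))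
    rw [preimage_proj_image_cell]
    exact isOpen_cell hρ p₀
  open_target := isOpen_cellTarget hρ p₀
  continuousOn_toFun := by
    have ho : IsOpen (proj hρ '' cell hρ p₀) := by
      refine isOpen_coinduced.2 ?_
      change IsOpen (proj hρ ⁻¹' (proj hρ '' cell hρ p₀))
      rw [preimage_proj_image_cell]
      exact isOpen_cell hρ p₀
    rw [continuousOn_open_iff ho]
    intro W hW
    refine isOpen_coinduced.2 ?_
    change IsOpen (proj hρ ⁻¹' (proj hρ '' cell hρ p₀ ∩ _))
    rw [preimage_inter, preimage_proj_image_cell]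
    convert! (contMDiffOn_flagCoord hρ p₀).continuousOn.isOpen_inter_preimage
      (isOpen_cell hρ p₀) hW using 1
    ext p
    refine and_congr_right fun hp => ?_
    change flagCoord hρ p₀ (Quotient.out (proj hρ p)) ∈ W ↔ flagCoord hρ p₀ p ∈ W
    rw [flagCoord_out hρ hp]
  continuousOn_invFun :=
    (continuous_proj hρ).comp_continuousOn (contMDiffOn_cellSection hρ p₀).continuousOn

instance : ChartedSpace (FlagModel n) (FlagBundle hρ) where
  atlas := range (chart hρ)
  chartAt x := chart hρ (Quotient.out x)
  mem_chart_source x :=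
    ⟨Quotient.out x, mem_cell hρ _, Quotient.out_eq x⟩
  chart_mem_atlas _ := mem_range_self _

instance : IsManifold 𝓘(ℂ, FlagModel n) ω (FlagBundle hρ) := by
  refine isManifold_of_contDiffOn _ _ _ ?_
  rintro _ _ ⟨p₀, rfl⟩ ⟨p₁, rfl⟩
  simp only [modelWithCornersSelf_coe, modelWithCornersSelf_coe_symm, Function.comp_def, id,
    range_id, inter_univ]
  have hm : ∀ y ∈ ((chart hρ p₀).symm.trans (chart hρ p₁)).source,
      y ∈ cellTarget hρ p₀ ∧ cellSection hρ p₀ y ∈ cell hρ p₁ := by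
    intro y hy
    refine ⟨hy.1, ?_⟩
    rw [← preimage_proj_image_cell hρ p₁]
    exact hy.2
  have h1 : ContMDiffOn 𝓘(ℂ, FlagModel n) 𝓘(ℂ, FlagModel n) ω
      (flagCoord hρ p₁ ∘ cellSection hρ p₀) ((chart hρ p₀).symm.trans (chart hρ p₁)).source :=
    (contMDiffOn_flagCoord hρ p₁).comp
      ((contMDiffOn_cellSection hρ p₀).mono fun y hy => (hm y hy).1) fun y hy => (hm y hy).2
  refine (contMDiffOn_iff_contDiffOn.1 h1).congr fun y hy => ?_
  exact flagCoord_out hρ (hm y hy).2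

/-- The projection `P → X` is holomorphic. Its local holomorphic sections are given by
`contMDiffOn_cellSection`. -/
theorem contMDiff_proj : ContMDiff 𝓘(ℂ, F) 𝓘(ℂ, FlagModel n) ω (proj hρ) := by
  intro p
  rw [contMDiffAt_iff_target]
  refine ⟨(continuous_proj hρ).continuousAt, ?_⟩
  set p₀ : P := Quotient.out (proj hρ p) with hp₀
  have hp : p ∈ cell hρ p₀ := by
    rw [← preimage_proj_image_cell]
    exact ⟨p₀, mem_cell hρ p₀, Quotient.out_eq (proj hρ p)⟩
  have hn := (isOpen_cell hρ p₀).mem_nhds hp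
  refine ((contMDiffOn_flagCoord hρ p₀).contMDiffAt hn).congr_of_eventuallyEq ?_
  filter_upwards [hn] with q hq
  exact flagCoord_out hρ hq

/-- The fibre at `x` of the vector bundle `P ×_{B⁺} 𝔫⁻` over `X` associated with the action of
`B⁺` on `𝔫⁻ ≅ 𝔰𝔩_n(ℂ) / 𝔟⁺`: the equivariant maps from the fibre of `P → X` over `x` to `𝔫⁻`. -/
def assocFibre (x : FlagBundle hρ) : Submodule ℂ ({p : P // proj hρ p = x} → nMinus n) where
  carrier := {f | ∀ (p : {p : P // proj hρ p = x}) (b : BPlus n),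
    f ⟨p.1 <• b.1, (proj_action hρ p.1 b).trans p.2⟩ = adMinus b⁻¹ (f p)}
  zero_mem' := by intro p b; simp
  add_mem' := by intro f g hf hg p b; simp [hf p b, hg p b]
  smul_mem' := by intro c f hf p b; simp [hf p b]

/-- A (not necessarily holomorphic) 1-form on `X` with values in the bundle `P ×_{B⁺} 𝔫⁻`. -/
abbrev AssocForm : Type _ :=
  ∀ x : FlagBundle hρ, TangentSpace 𝓘(ℂ, FlagModel n) x →ₗ[ℂ] assocFibre hρ x

variable {hρ}

open Classical in
/-- A 1-form on `X` with values in `P ×_{B⁺} 𝔫⁻` is holomorphic if it is given by a holomorphic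
`𝔫⁻`-valued 1-form in each local frame, that is, in the trivialization of `P ×_{B⁺} 𝔫⁻` induced
by a holomorphic section `s` of `P → X` over an open set `V`. -/
def AssocForm.IsHolomorphic (θ : AssocForm hρ) : Prop :=
  ∀ (V : Set (FlagBundle hρ)) (s : FlagBundle hρ → P), IsOpen V →
    ContMDiffOn 𝓘(ℂ, FlagModel n) 𝓘(ℂ, F) ω s V → (∀ x ∈ V, proj hρ (s x) = x) →
    ∀ i j : Fin n, ContMDiffOn 𝓘(ℂ, FlagModel n).tangent 𝓘(ℂ) ω
      (fun w : TangentBundle 𝓘(ℂ, FlagModel n) (FlagBundle hρ) =>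
        if h : proj hρ (s w.proj) = w.proj then ((θ w.proj w.snd).1 ⟨s w.proj, h⟩).1 i j else 0)
      {w | w.proj ∈ V}

/-- The `P ×_{B⁺} 𝔫⁻`-valued form `θ` on `X` pulls back to `ω⁻` on `P`. -/
def AssocForm.PullsBackToMinus [IsManifold 𝓘(ℂ, F) ω P] (θ : AssocForm hρ) (A : HolomorphicConnection n F P) : Prop :=
  ∀ (p : P) (v : TangentSpace 𝓘(ℂ, F) p),
    (θ (proj hρ p) (mfderiv 𝓘(ℂ, F) 𝓘(ℂ, FlagModel n) (proj hρ) p v)).1 ⟨p, rfl⟩ = A.minus p v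

variable (hρ)

/-- The direct image in `TX` of the horizontal distribution of a connection on `P`. -/
def inducedFoliation [IsManifold 𝓘(ℂ, F) ω P] (A : HolomorphicConnection n F P) :
    Set (TangentBundle 𝓘(ℂ, FlagModel n) (FlagBundle hρ)) :=
  tangentMap 𝓘(ℂ, F) 𝓘(ℂ, FlagModel n) (proj hρ) '' A.horizontal

end FlagBundle

end Flag

/-- A holomorphic foliation by curves on a complex manifold `X`, as a subset of `TX`: a
distribution of rank one which is locally spanned by a nowhere vanishing holomorphic vector field
(such a distribution is automatically involutive). -/
def IsHolomorphicFoliationByCurves {F' : Type*} [NormedAddCommGroup F'] [NormedSpace ℂ F']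
    {X : Type*} [TopologicalSpace X] [ChartedSpace F' X] [IsManifold 𝓘(ℂ, F') ω X]
    (D : Set (TangentBundle 𝓘(ℂ, F') X)) : Prop :=
  ∀ x : X, ∃ (V : Set X) (Z : ∀ y : X, TangentSpace 𝓘(ℂ, F') y), IsOpen V ∧ x ∈ V ∧
    ContMDiffOn 𝓘(ℂ, F') 𝓘(ℂ, F').tangent ω
      (fun y => (⟨y, Z y⟩ : TangentBundle 𝓘(ℂ, F') X)) V ∧
    ∀ y ∈ V, Z y ≠ 0 ∧ ∀ w : TangentSpace 𝓘(ℂ, F') y,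
      (⟨y, w⟩ : TangentBundle 𝓘(ℂ, F') X) ∈ D ↔ ∃ c : ℂ, w = c • Z y

end

/-!
The proof rests on the kernel of `dπ`, for the projection `π : P → X = P / B⁺`. Through each point
`p` of `P` there is a holomorphic local section `s` of `π` with `s (π p) = p`
(`FlagBundle.localSection`), and the points near `p` are `q = s (π q) c(q)` with `c` holomorphic,
with values in `B⁺`, and `c(p) = 1`. By the Leibniz rule, a tangent vector `v` at `p` is
`ds (dπ v)` plus the value of the fundamental vector field of `dc(v) ∈ 𝔟⁺`. Since the connection
form reproduces the generators of fundamental vector fields, `ω⁻(v) = ω⁻(ds (dπ v))`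
(`FlagBundle.minusAt_localSection`): `ω⁻(v)` depends only on `dπ v`. With the equivariance of `ω⁻`,
this gives the form `FlagBundle.minusForm` on `X`. It is unique because `dπ` is surjective, and
holomorphic because in the frame of a section `s` it is `s^* ω⁻`.

Conversely, each `ξ ∈ 𝔟⁺` is the velocity of an explicit holomorphic curve in `B⁺` (`bPlusCurve`),
so that fundamental vector fields of `𝔟⁺` lie in the kernel of `dπ`. A vector `v` with `ω⁻(v) = 0`,
that is `ω(v) ∈ 𝔟⁺`, becomes horizontal after subtracting such a field, without changing `dπ v`;
hence the image of the horizontal distribution is the kernel of the induced form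
(`FlagBundle.mem_inducedFoliation_iff_minusAt`).

For the rank, take the coordinates `(z, n₋)` of a chart of `X`, with `n₋` lower unipotent. In
the frame of the section `(z, n₋) ↦ σ(z) n₋` of `π`, the induced form is
`ω⁻(∂_z) dz + n₋⁻¹ dn₋`, as the Maurer–Cartan form of `N⁻` takes values in `𝔫⁻`
(`FlagBundle.formAt_cellSection_vertical`). Its kernel is thus the line spanned by the holomorphic
vector field `∂_z - n₋ ω⁻(∂_z)` (`FlagBundle.leafField`).
-/

noncomputable section

/-! ### Holomorphic maps to `SL_n(ℂ)` -/

namespace SLn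

theorem lower_zero {n : ℕ} : lower (0 : LowModel n) = 1 := by
  apply Subtype.ext
  ext i j
  rcases lt_trichotomy i j with h | h | h
  · simp [lower, h.not_gt, h.ne]
  · simp [lower, h]
  · simp [lower, h, h.ne']

theorem lowCoord_one {n : ℕ} : lowCoord (1 : SLn n) = 0 := by
  rw [← lower_zero, lowCoord_lower]

variable {n : ℕ} [NeZero n]

/-- The entries of `g⁻¹ h` are polynomials in those of `g` and `h`. -/
theorem contMDiffOn_inv_mul {E : Type*} [NormedAddCommGroup E] [NormedSpace ℂ E]
    {M : Type*} [TopologicalSpace M] [ChartedSpace E M] {g h : M → SLn n} {s : Set M}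
    (hg : ContMDiffOn 𝓘(ℂ, E) 𝓘(ℂ, SLModel n) ω g s)
    (hh : ContMDiffOn 𝓘(ℂ, E) 𝓘(ℂ, SLModel n) ω h s) :
    ContMDiffOn 𝓘(ℂ, E) 𝓘(ℂ, SLModel n) ω (fun m => (g m)⁻¹ * h m) s := by
  refine contMDiffOn_of_entries fun i j => ?_
  have hentry : ∀ i j, ContMDiffOn 𝓘(ℂ, E) 𝓘(ℂ) ω (fun m => (g m).1 i j) s :=
    fun i j => (contMDiff_entry i j).comp_contMDiffOn hg
  change ContMDiffOn _ _ _ (fun m => ((g m).1.adjugate * (h m).1) i j) _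
  simp only [Matrix.mul_apply, Matrix.adjugate_apply]
  refine contMDiffOn_finsetSum fun k _ =>
    ContMDiffOn.mul (contMDiffOn_det fun a b => ?_) ((contMDiff_entry k j).comp_contMDiffOn hh)
  by_cases ha : a = k
  · subst ha; simp only [updateRow_self]; exact contMDiffOn_const
  · simp only [updateRow_ne ha]; exact hentry a b

theorem contMDiff_lower :
    ContMDiff 𝓘(ℂ, LowModel n) 𝓘(ℂ, SLModel n) ω (lower : LowModel n → SLn n) := by
  simpa only [one_mul] using contMDiff_mul_lower (1 : SLn n)

end SLn

/-! ### Differentials in the model spaces -/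

section ModelDeriv

variable (E : Type*) [NormedAddCommGroup E] [NormedSpace ℂ E]
  (E' : Type*) [NormedAddCommGroup E'] [NormedSpace ℂ E']
  (E'' : Type*) [NormedAddCommGroup E''] [NormedSpace ℂ E'']
  {M : Type*} [TopologicalSpace M] [ChartedSpace E M]
  {M' : Type*} [TopologicalSpace M'] [ChartedSpace E' M']
  {M'' : Type*} [TopologicalSpace M''] [ChartedSpace E'' M'']

/-- The differential of `f` at `m` as a map between the model spaces, with which all tangent
spaces are identified as types. Equations between tangent vectors at points that are equal, but
not by definition, can then be stated without transport. -/
def modelDeriv (f : M → M') (m : M) : E →L[ℂ] E' := mfderiv 𝓘(ℂ, E) 𝓘(ℂ, E') f m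

theorem modelDeriv_congr {f g : M → M'} {m : M} (h : f =ᶠ[𝓝 m] g) :
    modelDeriv E E' f m = modelDeriv E E' g m :=
  h.mfderiv_eq

theorem modelDeriv_id (m : M) : modelDeriv E E (id : M → M) m = .id ℂ E :=
  mfderiv_id

theorem modelDeriv_const (x : M') (m : M) : modelDeriv E E' (fun _ : M => x) m = 0 :=
  mfderiv_const

theorem modelDeriv_comp {g : M' → M''} {f : M → M'} {m : M} {x : M'} (hx : f m = x)
    (hg : MDifferentiableAt 𝓘(ℂ, E') 𝓘(ℂ, E'') g x)
    (hf : MDifferentiableAt 𝓘(ℂ, E) 𝓘(ℂ, E') f m) (v : E) :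
    modelDeriv E E'' (fun y => g (f y)) m v = modelDeriv E' E'' g x (modelDeriv E E' f m v) :=
  mfderiv_comp_apply_of_eq m hg hf hx v

theorem modelDeriv_eq_fderiv (f : E → E') (x : E) : modelDeriv E E' f x = fderiv ℂ f x :=
  mfderiv_eq_fderiv

end ModelDeriv

/-! ### The connection form along orbits -/

section Connection

variable {n : ℕ} [NeZero n]
  {C : Type*} [TopologicalSpace C] [ChartedSpace ℂ C]
  {F : Type*} [NormedAddCommGroup F] [NormedSpace ℂ F]
  {P : Type*} [TopologicalSpace P] [ChartedSpace F P]
  [MulAction (SLn n)ᵐᵒᵖ P] {ρ : P → C}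
  {E : Type*} [NormedAddCommGroup E] [NormedSpace ℂ E]
  {M : Type*} [TopologicalSpace M] [ChartedSpace E M]

namespace IsHolomorphicPrincipalBundle

theorem contMDiff_orbit (hρ : IsHolomorphicPrincipalBundle n F ρ) (p : P) :
    ContMDiff 𝓘(ℂ, SLModel n) 𝓘(ℂ, F) ω fun g : SLn n => p <• g :=
  hρ.contMDiff_action.comp (contMDiff_const.prodMk contMDiff_id)

theorem contMDiff_translation (hρ : IsHolomorphicPrincipalBundle n F ρ) (g : SLn n) :
    ContMDiff 𝓘(ℂ, F) 𝓘(ℂ, F) ω fun p : P => p <• g :=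
  hρ.contMDiff_action.comp (contMDiff_id.prodMk contMDiff_const)

/-- The Leibniz rule for the action, at a point where the group element is `1`. -/
theorem modelDeriv_action (hρ : IsHolomorphicPrincipalBundle n F ρ) {f : M → P} {g : M → SLn n}
    {m : M} (hf : MDifferentiableAt 𝓘(ℂ, E) 𝓘(ℂ, F) f m)
    (hg : MDifferentiableAt 𝓘(ℂ, E) 𝓘(ℂ, SLModel n) g m) (h1 : g m = 1) (v : E) :
    modelDeriv E F (fun x => f x <• g x) m v =
      modelDeriv E F f m v + modelDeriv E F (fun x => f m <• g x) m v := by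
  have ha := (hρ.contMDiff_action.mdifferentiable (by simp)) (f m, g m)
  have e1 := mfderiv_comp_apply (g := fun x : P × SLn n => x.1 <• x.2) m ha (hf.prodMk hg) v
  rw [mfderiv_prod_eq_add_apply ha, mfderiv_prodMk hf hg] at e1
  have ho := ((hρ.contMDiff_orbit (f m)).mdifferentiable (by simp)) (g m)
  have h2 : (fun z : P => z <• g m) = id := by
    funext z; rw [h1]; exact one_smul _ z
  have e3 : modelDeriv F F (fun z : P => z <• g m) (f m) (modelDeriv E F f m v) =
      modelDeriv E F f m v := by
    rw [h2, modelDeriv_id]; rfl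
  rw [modelDeriv_comp E (SLModel n) F rfl ho hg, ← e3]
  exact e1

end IsHolomorphicPrincipalBundle

namespace HolomorphicConnection

variable [IsManifold 𝓘(ℂ, F) ω P]

/-- The connection form at `p` as a matrix-valued linear map on the model space. -/
def formAt (A : HolomorphicConnection n F P) (p : P) : F →ₗ[ℂ] Matrix (Fin n) (Fin n) ℂ :=
  (sln n).subtype ∘ₗ A.form p

/-- The `𝔫⁻`-part of the connection form at `p` as a linear map on the model space. -/
def minusAt (A : HolomorphicConnection n F P) (p : P) : F →ₗ[ℂ] nMinus n :=
  projMinus n ∘ₗ A.formAt p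

theorem trace_formAt (A : HolomorphicConnection n F P) (p : P) (v : F) :
    (A.formAt p v).trace = 0 :=
  (A.form p v).2

/-- On a curve (or a family) `p <• g` through `p`, the connection form is the derivative of the
matrix `g`. -/
theorem formAt_orbit (A : HolomorphicConnection n F P)
    (hρ : IsHolomorphicPrincipalBundle n F ρ) {g : M → SLn n} {m : M}
    (hg : MDifferentiableAt 𝓘(ℂ, E) 𝓘(ℂ, SLModel n) g m) (h1 : g m = 1) (p : P)
    (v : E) (i j : Fin n) :
    A.formAt p (modelDeriv E F (fun x => p <• g x) m v) i j =
      modelDeriv E ℂ (fun x => (g x).1 i j) m v := by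
  have ho := ((hρ.contMDiff_orbit p).mdifferentiable (by simp)) (1 : SLn n)
  have hent := ((SLn.contMDiff_entry (n := n) i j).mdifferentiable (by simp)) (1 : SLn n)
  rw [modelDeriv_comp E (SLModel n) F h1 ho hg,
    modelDeriv_comp E (SLModel n) ℂ (g := fun g : SLn n => g.1 i j) h1 hent hg]
  have h := A.form_fundamentalField p (modelDeriv E (SLModel n) g m v)
  have h3 : p <• (1 : SLn n) = p := one_smul _ p
  have h4 : A.formAt (p <• (1 : SLn n)) (modelDeriv (SLModel n) F (fun g : SLn n => p <• g) 1
      (modelDeriv E (SLModel n) g m v)) i j = modelDeriv (SLModel n) ℂ (fun g : SLn n => g.1 i j) 1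
      (modelDeriv E (SLModel n) g m v) := congrFun (congrFun h i) j
  rwa [h3] at h4

theorem formAt_action (A : HolomorphicConnection n F P) (g : SLn n) (p : P) (v : F) :
    A.formAt (p <• g) (modelDeriv F F (fun q : P => q <• g) p v) =
      (g⁻¹).1 * A.formAt p v * g.1 :=
  A.form_action g p v

theorem minusAt_eq_zero_iff (A : HolomorphicConnection n F P) (p : P) (v : F) :
    A.minusAt p v = 0 ↔ A.formAt p v ∈ bPlus n := by
  rw [Subtype.ext_iff]
  constructor
  · intro h
    refine ⟨A.trace_formAt p v, fun i j hij => ?_⟩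
    have := congrFun (congrFun h i) j
    simpa [minusAt, projMinus, hij] using this
  · intro h
    ext i j
    by_cases hij : j < i
    · simp [minusAt, projMinus, hij, h.2 i j hij]
    · simp [minusAt, projMinus, hij]

/-- The equivariance of `ω⁻`, for the action of `B⁺` on `𝔫⁻ ≅ 𝔰𝔩_n(ℂ) / 𝔟⁺`. -/
theorem minusAt_action (A : HolomorphicConnection n F P) (b : BPlus n) (p : P) (v : F) :
    A.minusAt (p <• b.1) (modelDeriv F F (fun q : P => q <• b.1) p v) =
      adMinus b⁻¹ (A.minusAt p v) := by
  change projMinus n (A.formAt _ _) =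
    projMinus n (((b.1)⁻¹ : SLn n).1 * (projMinus n (A.formAt p v)).1 * ((b.1⁻¹)⁻¹ : SLn n).1)
  rw [A.formAt_action, inv_inv, ← sub_eq_zero, ← map_sub, ← Matrix.sub_mul, ← Matrix.mul_sub]
  -- conjugation by `b⁻¹` keeps the upper triangular part of the form upper triangular
  have hU : Matrix.BlockTriangular (A.formAt p v - (projMinus n (A.formAt p v)).1) id := by
    intro i j hij
    have hij' : j < i := hij
    simp [projMinus, hij']
  have hT : Matrix.BlockTriangular (((b.1)⁻¹ : SLn n).1 *
      (A.formAt p v - (projMinus n (A.formAt p v)).1) * b.1.1) id :=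
    (Matrix.BlockTriangular.mul (fun i j h => (BPlus n).inv_mem b.2 i j h) hU).mul
      fun i j h => b.2 i j h
  ext i j
  by_cases hij : j < i
  · simpa [projMinus, hij] using hT hij
  · simp [projMinus, hij]

end HolomorphicConnection

/-- The holomorphic curve `t ↦ γ(t)` in `B⁺` with `γ(0) = 1` and `γ'(0) = ξ`, for `ξ` in `𝔟⁺`:
the diagonal entries are `exp (t ξᵢᵢ)`, with product `exp (t tr ξ) = 1`, and those above the
diagonal are `t ξᵢⱼ`. -/
def bPlusCurve {n : ℕ} (ξ : bPlus n) (t : ℂ) : SLn n :=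
  ⟨Matrix.of fun i j => if i = j then Complex.exp (t * ξ.1 i i) else t * ξ.1 i j, by
    rw [Matrix.det_of_isUpperTriangular]
    · simp only [Matrix.of_apply, if_true]
      have h : ∑ i, ξ.1 i i = 0 := ξ.2.1
      rw [← Complex.exp_sum, ← Finset.mul_sum, h, mul_zero, Complex.exp_zero]
    · intro i j h
      have h' : j < i := h
      simp [h'.ne', ξ.2.2 i j h']⟩

theorem bPlusCurve_mem {n : ℕ} (ξ : bPlus n) (t : ℂ) : bPlusCurve ξ t ∈ BPlus n := by
  intro i j h
  simp [bPlusCurve, h.ne', ξ.2.2 i j h]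

theorem bPlusCurve_zero {n : ℕ} (ξ : bPlus n) : bPlusCurve ξ 0 = 1 := by
  apply Subtype.ext
  ext i j
  by_cases h : i = j
  · simp [bPlusCurve, h]
  · simp [bPlusCurve, h]

theorem hasDerivAt_bPlusCurve {n : ℕ} (ξ : bPlus n) (i j : Fin n) :
    HasDerivAt (fun t => (bPlusCurve ξ t).1 i j) (ξ.1 i j) 0 := by
  by_cases h : i = j
  · subst h
    simpa [bPlusCurve] using ((hasDerivAt_id (0 : ℂ)).mul_const (ξ.1 i i)).cexp
  · simpa [bPlusCurve, h] using (hasDerivAt_id (0 : ℂ)).mul_const (ξ.1 i j)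

theorem contMDiff_bPlusCurve (ξ : bPlus n) :
    ContMDiff 𝓘(ℂ) 𝓘(ℂ, SLModel n) ω (bPlusCurve ξ) := by
  rw [← contMDiffOn_univ]
  refine SLn.contMDiffOn_of_entries fun i j => ?_
  rw [contMDiffOn_univ, contMDiff_iff_contDiff]
  by_cases h : i = j
  · simp only [bPlusCurve, Matrix.of_apply, if_pos h]
    exact (contDiff_id.mul contDiff_const).cexp
  · simp only [bPlusCurve, Matrix.of_apply, if_neg h]
    exact contDiff_id.mul contDiff_const

/-- The fundamental vector fields of `𝔟⁺` are tangent to the `B⁺`-orbits, and the connection form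
takes any value in `𝔟⁺` on them. -/
theorem HolomorphicConnection.exists_tangent_orbit [IsManifold 𝓘(ℂ, F) ω P]
    [IsManifold 𝓘(ℂ) ω C] (A : HolomorphicConnection n F P)
    (hρ : IsHolomorphicPrincipalBundle n F ρ) (p : P) {ξ : Matrix (Fin n) (Fin n) ℂ}
    (hξ : ξ ∈ bPlus n) :
    ∃ v : F, A.formAt p v = ξ ∧
      modelDeriv F (FlagModel n) (FlagBundle.proj hρ) p v = 0 := by
  set γ := bPlusCurve ⟨ξ, hξ⟩ with hγ
  have hγd := (contMDiff_bPlusCurve ⟨ξ, hξ⟩).mdifferentiable (by simp) (0 : ℂ)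
  have h1 : γ 0 = 1 := bPlusCurve_zero _
  refine ⟨modelDeriv ℂ F (fun t => p <• γ t) 0 1, ?_, ?_⟩
  · ext i j
    rw [A.formAt_orbit hρ hγd h1, modelDeriv_eq_fderiv]
    exact (hasDerivAt_bPlusCurve ⟨ξ, hξ⟩ i j).deriv
  · have hp : p <• γ 0 = p := by rw [h1]; exact one_smul _ p
    have ho : MDifferentiableAt 𝓘(ℂ) 𝓘(ℂ, F) (fun t => p <• γ t) 0 :=
      ((hρ.contMDiff_orbit p).mdifferentiable (by simp) (γ 0)).comp 0 hγd
    rw [← modelDeriv_comp ℂ F (FlagModel n) (f := fun t => p <• γ t) hp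
      ((FlagBundle.contMDiff_proj hρ).mdifferentiable (by simp) p) ho]
    have hc : (fun t => FlagBundle.proj hρ (p <• γ t)) = fun _ => FlagBundle.proj hρ p := by
      funext t
      exact FlagBundle.proj_action hρ p ⟨γ t, bPlusCurve_mem _ t⟩
    rw [hc, modelDeriv_const]
    rfl

end Connection

/-! ### Local sections of `P → X` -/

namespace FlagBundle

variable {n : ℕ} [NeZero n]
  {C : Type*} [TopologicalSpace C] [ChartedSpace ℂ C]
  {F : Type*} [NormedAddCommGroup F] [NormedSpace ℂ F]
  {P : Type*} [TopologicalSpace P] [ChartedSpace F P]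
  [MulAction (SLn n)ᵐᵒᵖ P] {ρ : P → C} (hρ : IsHolomorphicPrincipalBundle n F ρ)

theorem frame_self (p : P) : frame hρ p p = 1 := inv_mul_cancel _

/-- The factor in `B⁺` by which `q` differs from the point of the unipotent section in the same
`B⁺`-orbit. -/
def cellFactor (p q : P) : SLn n :=
  (SLn.lower (SLn.lowCoord (frame hρ p q)))⁻¹ * frame hρ p q

theorem cellFactor_mem {p q : P} (hq : q ∈ cell hρ p) : cellFactor hρ p q ∈ BPlus n := by
  obtain ⟨b, hb, h⟩ := SLn.exists_lower_eq hq.2.2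
  unfold cellFactor
  rw [h, _root_.mul_inv_rev, inv_mul_cancel_right]
  exact (BPlus n).inv_mem hb

theorem cellFactor_self (p : P) : cellFactor hρ p p = 1 := by
  unfold cellFactor
  rw [frame_self, SLn.lowCoord_one, SLn.lower_zero, inv_one, mul_one]

theorem contMDiffOn_cellFactor (p : P) :
    ContMDiffOn 𝓘(ℂ, F) 𝓘(ℂ, SLModel n) ω (cellFactor hρ p) (cell hρ p) := by
  have hf := (contMDiffOn_frame hρ p).mono fun q (hq : q ∈ cell hρ p) => hq.1
  exact SLn.contMDiffOn_inv_mul (SLn.contMDiff_lower.comp_contMDiffOn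
    (SLn.contMDiffOn_lowCoord.comp hf fun q hq => hq.2.2)) hf

variable [IsManifold 𝓘(ℂ) ω C]

theorem mdifferentiable_proj : MDifferentiable 𝓘(ℂ, F) 𝓘(ℂ, FlagModel n) (proj hρ) :=
  (contMDiff_proj hρ).mdifferentiable (by simp)

theorem contMDiffOn_chart_source (p : P) :
    ContMDiffOn 𝓘(ℂ, FlagModel n) 𝓘(ℂ, FlagModel n) ω (chart hρ p) (chart hρ p).source :=
  contMDiffOn_of_mem_maximalAtlas (IsManifold.subset_maximalAtlas (mem_range_self p))

theorem chart_proj {p q : P} (hq : q ∈ cell hρ p) : chart hρ p (proj hρ q) = flagCoord hρ p q :=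
  flagCoord_out hρ hq

/-- The holomorphic section of `P → X` over the chart domain around the class of `p` which passes
through `p`. -/
def localSection (p : P) (x : FlagBundle hρ) : P := cellSection hρ p (chart hρ p x)

theorem contMDiffOn_localSection (p : P) :
    ContMDiffOn 𝓘(ℂ, FlagModel n) 𝓘(ℂ, F) ω (localSection hρ p) (chart hρ p).source :=
  (contMDiffOn_cellSection hρ p).comp (contMDiffOn_chart_source hρ p)
    fun _ hx => (chart hρ p).map_source hx

theorem mdifferentiableAt_localSection (p : P) {x : FlagBundle hρ}
    (hx : x ∈ (chart hρ p).source) :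
    MDifferentiableAt 𝓘(ℂ, FlagModel n) 𝓘(ℂ, F) (localSection hρ p) x :=
  ((contMDiffOn_localSection hρ p).contMDiffAt
    ((chart hρ p).open_source.mem_nhds hx)).mdifferentiableAt (by simp)

theorem proj_localSection (p : P) {x : FlagBundle hρ} (hx : x ∈ (chart hρ p).source) :
    proj hρ (localSection hρ p x) = x :=
  (chart hρ p).left_inv hx

theorem proj_mem_source (p : P) : proj hρ p ∈ (chart hρ p).source :=
  mem_image_of_mem _ (mem_cell hρ p)

theorem localSection_self (p : P) : localSection hρ p (proj hρ p) = p := by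
  unfold localSection
  rw [chart_proj hρ (mem_cell hρ p)]
  have hT := flagCoord_mem_target hρ (mem_cell hρ p)
  refine (triv hρ p).injOn (cellSection_mem_source hρ hT) (mem_cell hρ p).1 ?_
  rw [triv_cellSection hρ hT]
  refine Prod.ext ?_ ?_
  · rw [((triv_spec hρ p).2.2.2.2.2.2 p (mem_cell hρ p).1).1]
    exact (chartAt ℂ (ρ p)).left_inv (mem_cell hρ p).2.1
  · change _ * SLn.lower (SLn.lowCoord (frame hρ p p)) = _
    rw [frame_self, SLn.lowCoord_one, SLn.lower_zero, mul_one]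

theorem localSection_action {p q : P} (hq : q ∈ cell hρ p) :
    localSection hρ p (proj hρ q) <• cellFactor hρ p q = q := by
  unfold localSection
  rw [chart_proj hρ hq]
  have hT := flagCoord_mem_target hρ hq
  have hS := cellSection_mem_source hρ hT
  have hs := (triv_spec hρ p).2.2.2.2.2.2
  refine (triv hρ p).injOn (action_mem_source hρ hS _) hq.1 (Prod.ext ?_ ?_)
  · rw [(hs _ (action_mem_source hρ hS _)).1, hρ.proj_action, base_cellSection hρ hT,
      (hs _ hq.1).1]
    exact (chartAt ℂ (ρ p)).left_inv hq.2.1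
  · rw [(hs _ hS).2, triv_cellSection hρ hT]
    change (triv hρ p p).2 * SLn.lower (SLn.lowCoord (frame hρ p q)) * cellFactor hρ p q = _
    unfold cellFactor
    rw [mul_assoc, mul_inv_cancel_left, frame, mul_inv_cancel_left]

/-- The differential of a section of `P → X` is a right inverse of that of the projection. -/
theorem modelDeriv_proj_section {s : FlagBundle hρ → P} {x : FlagBundle hρ}
    (hs : MDifferentiableAt 𝓘(ℂ, FlagModel n) 𝓘(ℂ, F) s x)
    (h : ∀ᶠ y in 𝓝 x, proj hρ (s y) = y) (w : FlagModel n) :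
    modelDeriv F (FlagModel n) (proj hρ) (s x) (modelDeriv (FlagModel n) F s x w) = w := by
  rw [← modelDeriv_comp (FlagModel n) F (FlagModel n) rfl (mdifferentiable_proj hρ _) hs,
    modelDeriv_congr (FlagModel n) (FlagModel n) (g := id) h, modelDeriv_id]
  rfl

theorem modelDeriv_proj_localSection (p : P) (w : FlagModel n) :
    modelDeriv F (FlagModel n) (proj hρ) p
      (modelDeriv (FlagModel n) F (localSection hρ p) (proj hρ p) w) = w := by
  have h := modelDeriv_proj_section hρ
    (mdifferentiableAt_localSection hρ p (proj_mem_source hρ p))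
    (Filter.eventually_of_mem ((chart hρ p).open_source.mem_nhds (proj_mem_source hρ p))
      fun y hy => proj_localSection hρ p hy) w
  rwa [localSection_self] at h

theorem modelDeriv_proj_action (b : BPlus n) (p : P) (v : F) :
    modelDeriv F (FlagModel n) (proj hρ) (p <• b.1)
      (modelDeriv F F (fun q : P => q <• b.1) p v) =
      modelDeriv F (FlagModel n) (proj hρ) p v := by
  rw [← modelDeriv_comp F F (FlagModel n) (f := fun q : P => q <• b.1) rfl
    (mdifferentiable_proj hρ _) ((hρ.contMDiff_translation b.1).mdifferentiable (by simp) p)]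
  have : (fun q : P => proj hρ (q <• b.1)) = proj hρ := funext fun q => proj_action hρ q b
  rw [this]

/-! ### The form `ω⁻` on `P` and the form it induces on `X` -/

variable [IsManifold 𝓘(ℂ, F) ω P] (A : HolomorphicConnection n F P)

/-- `ω⁻` depends only on the image of a tangent vector in `X`. Writing points `q` near `p` as
`s (q B⁺) c(q)` with `s` the local section through `p` and `c` with values in `B⁺`, a tangent vector
at `p` differs from its image under `ds ∘ dπ` by the value of a fundamental vector field of
`𝔟⁺`. -/
theorem minusAt_localSection (p : P) (v : F) :
    A.minusAt p (modelDeriv (FlagModel n) F (localSection hρ p) (proj hρ p)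
      (modelDeriv F (FlagModel n) (proj hρ) p v)) = A.minusAt p v := by
  have hcell := (isOpen_cell hρ p).mem_nhds (mem_cell hρ p)
  have hs := mdifferentiableAt_localSection hρ p (proj_mem_source hρ p)
  have hsπ : MDifferentiableAt 𝓘(ℂ, F) 𝓘(ℂ, F) (fun q => localSection hρ p (proj hρ q)) p :=
    hs.comp p (mdifferentiable_proj hρ p)
  have hc : MDifferentiableAt 𝓘(ℂ, F) 𝓘(ℂ, SLModel n) (cellFactor hρ p) p :=
    ((contMDiffOn_cellFactor hρ p).contMDiffAt hcell).mdifferentiableAt (by simp)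
  have h1 := hρ.modelDeriv_action hsπ hc (cellFactor_self hρ p) v
  have h2 : (fun q => localSection hρ p (proj hρ q) <• cellFactor hρ p q) =ᶠ[𝓝 p] id :=
    Filter.eventually_of_mem hcell fun q hq => localSection_action hρ hq
  rw [modelDeriv_congr F F h2, modelDeriv_id, localSection_self,
    modelDeriv_comp F (FlagModel n) F (g := localSection hρ p) rfl hs
      (mdifferentiable_proj hρ p)] at h1
  have h3 : A.minusAt p (modelDeriv F F (fun q => p <• cellFactor hρ p q) p v) = 0 := by
    rw [A.minusAt_eq_zero_iff]
    refine ⟨A.trace_formAt _ _, fun i j hij => ?_⟩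
    rw [A.formAt_orbit hρ hc (cellFactor_self hρ p), modelDeriv_congr F ℂ (g := fun _ => 0),
      modelDeriv_const]
    · rfl
    · exact Filter.eventually_of_mem hcell fun q hq => cellFactor_mem hρ hq i j hij
  have h4 := congrArg (A.minusAt p) h1
  rw [map_add, h3, add_zero] at h4
  exact h4.symm

theorem minusAt_eq_of_proj {p : P} {v v' : F}
    (h : modelDeriv F (FlagModel n) (proj hρ) p v = modelDeriv F (FlagModel n) (proj hρ) p v') :
    A.minusAt p v = A.minusAt p v' := by
  rw [← minusAt_localSection hρ A p v, h, minusAt_localSection]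

/-- The foliation at a point of `X` can be computed from any point `p` above it. -/
theorem mem_inducedFoliation_iff_exists (p : P) (w : FlagModel n) :
    (⟨proj hρ p, w⟩ : TangentBundle 𝓘(ℂ, FlagModel n) (FlagBundle hρ)) ∈ inducedFoliation hρ A ↔
      ∃ v : F, A.formAt p v = 0 ∧ modelDeriv F (FlagModel n) (proj hρ) p v = w := by
  constructor
  · rintro ⟨⟨q, v⟩, hv, he⟩
    have h1 : proj hρ p = proj hρ q := (congrArg (fun t => t.proj) he).symm
    have h2 : modelDeriv F (FlagModel n) (proj hρ) q v = w :=
      congrArg (fun t : TangentBundle 𝓘(ℂ, FlagModel n) (FlagBundle hρ) =>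
        (t.snd : FlagModel n)) he
    obtain ⟨b, hb, rfl⟩ := (proj_eq_iff hρ).1 h1
    -- the horizontal distribution is invariant under translation by `b`
    suffices ∀ v : F, A.formAt q v = 0 → A.formAt (q <• b)
        (modelDeriv F F (fun q : P => q <• b) q v) = 0 from
      ⟨modelDeriv F F (fun q : P => q <• b) q v, this v (congrArg Subtype.val hv),
        (modelDeriv_proj_action hρ ⟨b, hb⟩ q v).trans h2⟩
    intro v h0
    rw [A.formAt_action, h0, Matrix.mul_zero, Matrix.zero_mul]
  · rintro ⟨v, hv, rfl⟩
    exact ⟨⟨p, v⟩, Subtype.ext hv, rfl⟩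

/-- The foliation of `X` is cut out by `ω⁻`: a tangent vector `v` of `P` with `ω(v)` in `𝔟⁺` can be
made horizontal by subtracting the value of a fundamental vector field of `𝔟⁺`, which does not
change its image in `X`. -/
theorem mem_inducedFoliation_iff_minusAt (p : P) (v : F) :
    (⟨proj hρ p, modelDeriv F (FlagModel n) (proj hρ) p v⟩ :
      TangentBundle 𝓘(ℂ, FlagModel n) (FlagBundle hρ)) ∈ inducedFoliation hρ A ↔
      A.minusAt p v = 0 := by
  rw [mem_inducedFoliation_iff_exists]
  constructor
  · rintro ⟨v', h0, h⟩
    rw [minusAt_eq_of_proj hρ A h.symm]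
    change projMinus n (A.formAt p v') = 0
    rw [h0, map_zero]
  · intro h
    obtain ⟨u, hu, hu0⟩ := A.exists_tangent_orbit hρ p ((A.minusAt_eq_zero_iff p v).1 h)
    exact ⟨v - u, by rw [map_sub, hu, sub_self], by rw [map_sub, hu0, sub_zero]⟩

theorem minusAt_localSection_action (p : P) (b : BPlus n) (w : FlagModel n) :
    A.minusAt (p <• b.1)
        (modelDeriv (FlagModel n) F (localSection hρ (p <• b.1)) (proj hρ p) w) =
      adMinus b⁻¹ (A.minusAt p
        (modelDeriv (FlagModel n) F (localSection hρ p) (proj hρ p) w)) := by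
  rw [← A.minusAt_action]
  refine minusAt_eq_of_proj hρ A ?_
  rw [modelDeriv_proj_action, modelDeriv_proj_localSection, ← proj_action hρ p b,
    modelDeriv_proj_localSection]

/-- The 1-form on `X` with values in `P ×_{B⁺} 𝔫⁻` induced by `ω⁻`: its value at `w`, as an
equivariant map on the fibre of `P → X`, takes at `p` the value of `ω⁻` on any lift of `w` to `p`;
the lift by the local section through `p` makes linearity in `w` evident. -/
def minusForm : AssocForm hρ := fun x =>
  { toFun := fun w => ⟨fun p => A.minusAt p.1
        (modelDeriv (FlagModel n) F (localSection hρ p.1) x w), by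
      rintro ⟨p, rfl⟩ b
      exact minusAt_localSection_action hρ A p b w⟩
    map_add' := fun w w' => by
      ext p : 2
      exact ((A.minusAt p.1 ∘ₗ (modelDeriv (FlagModel n) F (localSection hρ p.1) x).toLinearMap)
        ).map_add w w'
    map_smul' := fun c w => by
      ext p : 2
      exact ((A.minusAt p.1 ∘ₗ (modelDeriv (FlagModel n) F (localSection hρ p.1) x).toLinearMap)
        ).map_smul c w }

theorem minusForm_proj (p : P) (v : F) :
    (minusForm hρ A (proj hρ p) (modelDeriv F (FlagModel n) (proj hρ) p v)).1 ⟨p, rfl⟩ =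
      A.minusAt p v :=
  minusAt_localSection hρ A p v

theorem eq_minusForm {θ : AssocForm hρ} (hθ : θ.PullsBackToMinus A) : θ = minusForm hρ A := by
  funext x
  refine LinearMap.ext fun w => Subtype.ext (funext fun p => ?_)
  obtain ⟨p, rfl⟩ := p
  have h := hθ p (modelDeriv (FlagModel n) F (localSection hρ p) (proj hρ p) w)
  have hw := modelDeriv_proj_localSection hρ p w
  have h' : (θ (proj hρ p) (modelDeriv F (FlagModel n) (proj hρ) p
      (modelDeriv (FlagModel n) F (localSection hρ p) (proj hρ p) w))).1 ⟨p, rfl⟩ =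
      A.minusAt p (modelDeriv (FlagModel n) F (localSection hρ p) (proj hρ p) w) := h
  rw [hw] at h'
  exact h'

/-- The value of the induced form is an equivariant map on an orbit of `B⁺`, so that it vanishes as
soon as it vanishes at one point. -/
theorem minusForm_eq_zero_iff (p : P) (v : F) :
    minusForm hρ A (proj hρ p) (modelDeriv F (FlagModel n) (proj hρ) p v) = 0 ↔
      A.minusAt p v = 0 := by
  constructor
  · intro h
    rw [← minusForm_proj hρ A p v, h]
    rfl
  · intro h
    refine Subtype.ext (funext ?_)
    rintro ⟨q, hq⟩
    obtain ⟨b, hb, rfl⟩ := (proj_eq_iff hρ).1 hq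
    refine ((minusForm hρ A (proj hρ p) (modelDeriv F (FlagModel n) (proj hρ) p v)).2
      ⟨p, rfl⟩ ⟨b, hb⟩).trans ?_
    rw [minusForm_proj, h, map_zero]
    rfl

theorem minusForm_apply_section {s : FlagBundle hρ → P} {x : FlagBundle hρ}
    (hs : MDifferentiableAt 𝓘(ℂ, FlagModel n) 𝓘(ℂ, F) s x)
    (h : ∀ᶠ y in 𝓝 x, proj hρ (s y) = y) (hx : proj hρ (s x) = x) (w : FlagModel n) :
    (minusForm hρ A x w).1 ⟨s x, hx⟩ = A.minusAt (s x) (modelDeriv (FlagModel n) F s x w) := by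
  have h1 := modelDeriv_proj_section hρ hs h w
  have h2 := modelDeriv_proj_localSection hρ (s x) w
  rw [hx] at h2
  -- two lifts of `w` to the point `s x`
  exact minusAt_eq_of_proj hρ A (h2.trans h1.symm)

/-- In the local frame of a section `s`, the induced form is the pull-back `s^* ω⁻`. -/
theorem isHolomorphic_minusForm : (minusForm hρ A).IsHolomorphic := by
  intro V s hV hs hπ i j
  have ht := hs.contMDiffOn_tangentMapWithin (m := ω) (by simp) hV.uniqueMDiffOn
  by_cases hij : j < i
  · refine ((A.holomorphic i j).comp_contMDiffOn ht).congr fun w hw => ?_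
    have hn := hV.mem_nhds hw
    rw [dif_pos (hπ _ hw)]
    have h := minusForm_apply_section hρ A ((hs.contMDiffAt hn).mdifferentiableAt (by simp))
      (Filter.eventually_of_mem hn hπ) (hπ _ hw) w.snd
    rw [h]
    simp only [Function.comp_apply]
    rw [tangentMapWithin_eq_tangentMap (hV.uniqueMDiffOn _ hw)
      ((hs.contMDiffAt hn).mdifferentiableAt (by simp))]
    exact if_pos hij
  · refine contMDiffOn_const (c := (0 : ℂ)) |>.congr fun w hw => ?_
    rw [dif_pos (hπ _ hw)]
    exact (((minusForm hρ A w.proj w.snd).1 ⟨s w.proj, hπ _ hw⟩).2 i j (not_lt.1 hij))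

end FlagBundle

/-! ### Strictly lower triangular matrices -/

namespace SLn

section StrictlyLower

variable {n : ℕ}

/-- The strictly lower triangular matrix with prescribed entries below the diagonal. -/
def lowMatrix (n : ℕ) : LowModel n →ₗ[ℂ] Matrix (Fin n) (Fin n) ℂ where
  toFun e := Matrix.of fun i j => if h : j < i then e ⟨(i, j), h⟩ else 0
  map_add' e e' := by
    ext i j
    by_cases h : j < i <;> simp [h]
  map_smul' c e := by
    ext i j
    by_cases h : j < i <;> simp [h]

theorem lower_val (e : LowModel n) : (lower e).1 = 1 + lowMatrix n e := by
  ext i j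
  rcases lt_trichotomy i j with h | h | h
  · simp [lower, lowMatrix, h.not_gt, h.ne]
  · simp [lower, lowMatrix, h]
  · simp [lower, lowMatrix, h, h.ne']

theorem lowMatrix_mem (e : LowModel n) : lowMatrix n e ∈ nMinus n := by
  intro i j h
  simp [lowMatrix, h.not_gt]

/-- The entries of a matrix below the diagonal. -/
def lowEntries (n : ℕ) : Matrix (Fin n) (Fin n) ℂ →ₗ[ℂ] LowModel n where
  toFun A q := A q.1.1 q.1.2
  map_add' _ _ := rfl
  map_smul' _ _ := rfl

theorem lowEntries_lowMatrix (e : LowModel n) : lowEntries n (lowMatrix n e) = e := by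
  funext ⟨⟨i, j⟩, h⟩
  exact dif_pos h

theorem lowMatrix_lowEntries {A : Matrix (Fin n) (Fin n) ℂ} (hA : A ∈ nMinus n) :
    lowMatrix n (lowEntries n A) = A := by
  ext i j
  by_cases h : j < i
  · exact dif_pos h
  · simp [lowMatrix, h, hA i j (not_lt.1 h)]

theorem projMinus_val_of_mem {A : Matrix (Fin n) (Fin n) ℂ} (hA : A ∈ nMinus n) :
    (projMinus n A).1 = A := by
  ext i j
  by_cases h : j < i
  · simp [projMinus, h]
  · simp [projMinus, h, hA i j (not_lt.1 h)]

theorem mul_mem_nMinus {A B : Matrix (Fin n) (Fin n) ℂ} (hA : ∀ i j, i < j → A i j = 0)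
    (hB : B ∈ nMinus n) : A * B ∈ nMinus n := by
  intro i j hij
  rw [Matrix.mul_apply]
  refine Finset.sum_eq_zero fun k _ => ?_
  rcases lt_or_ge i k with h | h
  · rw [hA i k h, zero_mul]
  · rw [hB k j (h.trans hij), mul_zero]

theorem lower_apply_of_lt (e : LowModel n) {i j : Fin n} (h : i < j) : (lower e).1 i j = 0 := by
  simp [lower, h.not_gt, h.ne]

theorem lower_inv_apply_of_lt (e : LowModel n) {i j : Fin n} (h : i < j) :
    ((lower e)⁻¹).1 i j = 0 := by
  have : Invertible (lower e).1 :=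
    Matrix.invertibleOfIsUnitDet _ (by rw [(lower e).2]; exact isUnit_one)
  have hT := Matrix.blockTriangular_inv_of_blockTriangular (b := OrderDual.toDual)
    (M := (lower e).1) fun i j h => lower_apply_of_lt e h
  have h2 := hT (show OrderDual.toDual j < OrderDual.toDual i from h)
  rw [Matrix.inv_def, (lower e).2] at h2
  simpa using h2

/-- The derivative of `e' ↦ n₋(e)⁻¹ n₋(e')`. -/
theorem hasFDerivAt_inv_mul_lower (e e' : LowModel n) (i j : Fin n) :
    HasFDerivAt (fun x : LowModel n => ((lower e)⁻¹ * lower x).1 i j)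
      (LinearMap.toContinuousLinearMap (Matrix.entryLinearMap ℂ ℂ i j ∘ₗ
        LinearMap.mulLeft ℂ ((lower e)⁻¹).1 ∘ₗ lowMatrix n)) e' := by
  refine HasFDerivAt.congr_of_eventuallyEq (f := fun x : LowModel n => ((lower e)⁻¹).1 i j +
    LinearMap.toContinuousLinearMap (Matrix.entryLinearMap ℂ ℂ i j ∘ₗ
        LinearMap.mulLeft ℂ ((lower e)⁻¹).1 ∘ₗ lowMatrix n) x)
    ((ContinuousLinearMap.hasFDerivAt _).const_add _) (Filter.Eventually.of_forall fun x => ?_)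
  change (((lower e)⁻¹).1 * (lower x).1) i j =
    ((lower e)⁻¹).1 i j + (((lower e)⁻¹).1 * lowMatrix n x) i j
  rw [lower_val x, Matrix.mul_add, Matrix.mul_one, Matrix.add_apply]

end StrictlyLower

end SLn

/-! ### The foliation in a chart of `X` -/

namespace FlagBundle

variable {n : ℕ} [NeZero n]
  {C : Type*} [TopologicalSpace C] [ChartedSpace ℂ C]
  {F : Type*} [NormedAddCommGroup F] [NormedSpace ℂ F]
  {P : Type*} [TopologicalSpace P] [ChartedSpace F P]
  [MulAction (SLn n)ᵐᵒᵖ P] {ρ : P → C} (hρ : IsHolomorphicPrincipalBundle n F ρ)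

theorem cellSection_action {p : P} {y : FlagModel n} (hy : y ∈ cellTarget hρ p)
    (e : LowModel n) :
    cellSection hρ p (y.1, e) = cellSection hρ p y <• ((SLn.lower y.2)⁻¹ * SLn.lower e) := by
  have hy' : (y.1, e) ∈ cellTarget hρ p := hy
  have hS := cellSection_mem_source hρ hy
  have hs := (triv_spec hρ p).2.2.2.2.2.2
  refine (triv hρ p).injOn (cellSection_mem_source hρ hy') (action_mem_source hρ hS _)
    (Prod.ext ?_ ?_)
  · rw [(hs _ (action_mem_source hρ hS _)).1, hρ.proj_action, base_cellSection hρ hy,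
      triv_cellSection hρ hy']
  · rw [(hs _ hS).2, triv_cellSection hρ hy', triv_cellSection hρ hy, mul_assoc,
      mul_inv_cancel_left]

variable [IsManifold 𝓘(ℂ) ω C]

theorem mdifferentiableAt_cellSection {p : P} {y : FlagModel n} (hy : y ∈ cellTarget hρ p) :
    MDifferentiableAt 𝓘(ℂ, FlagModel n) 𝓘(ℂ, F) (cellSection hρ p) y :=
  ((contMDiffOn_cellSection hρ p).contMDiffAt
    ((isOpen_cellTarget hρ p).mem_nhds hy)).mdifferentiableAt (by simp)

variable [IsManifold 𝓘(ℂ, F) ω P] (A : HolomorphicConnection n F P)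

/-- Along the fibre coordinates of the big cell, the connection form pulls back to the
Maurer–Cartan form `n₋⁻¹ dn₋`. -/
theorem formAt_cellSection_vertical {p : P} {y : FlagModel n} (hy : y ∈ cellTarget hρ p)
    (e : LowModel n) :
    A.formAt (cellSection hρ p y) (modelDeriv (FlagModel n) F (cellSection hρ p) y (0, e)) =
      ((SLn.lower y.2)⁻¹).1 * SLn.lowMatrix n e := by
  have hι : HasFDerivAt (fun e' : LowModel n => (y.1, e'))
      (ContinuousLinearMap.inr ℂ ℂ (LowModel n)) y.2 := hasFDerivAt_prodMk_right y.1 y.2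
  have h1 := modelDeriv_comp (LowModel n) (FlagModel n) F (g := cellSection hρ p)
    (f := fun e' : LowModel n => (y.1, e')) (m := y.2) (x := y) rfl
    (mdifferentiableAt_cellSection hρ hy) hι.differentiableAt.mdifferentiableAt e
  rw [modelDeriv_eq_fderiv, hι.fderiv, ContinuousLinearMap.inr_apply] at h1
  rw [← h1]
  rw [funext (cellSection_action hρ hy)]
  ext i j
  rw [A.formAt_orbit hρ ((SLn.contMDiff_mul_lower _).mdifferentiable (by simp) _)
    (inv_mul_cancel _), modelDeriv_eq_fderiv, (SLn.hasFDerivAt_inv_mul_lower _ _ i j).fderiv]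
  rfl

/-- The coordinates along the fibre of the tangent vector of the foliation with base coordinate
`1`: the solution `a` of `ω⁻(∂_z) + n₋⁻¹ a = 0`. -/
def slope (p : P) (y : FlagModel n) : LowModel n :=
  -SLn.lowEntries n ((SLn.lower y.2).1 *
    (A.minusAt (cellSection hρ p y)
      (modelDeriv (FlagModel n) F (cellSection hρ p) y (1, 0))).1)

/-- In the coordinates `(z, n₋)`, the pull-back of `ω⁻` by the unipotent section is
`ω⁻(∂_z) dz + n₋⁻¹ dn₋`, so that its kernel is the line spanned by `(1, slope)`. -/
theorem minusAt_cellSection_eq_zero_iff {p : P} {y : FlagModel n} (hy : y ∈ cellTarget hρ p)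
    (c : FlagModel n) :
    A.minusAt (cellSection hρ p y) (modelDeriv (FlagModel n) F (cellSection hρ p) y c) = 0 ↔
      c = c.1 • (1, slope hρ A p y) := by
  obtain ⟨ζ, e⟩ := c
  have hc : ((ζ, e) : FlagModel n) = ζ • (1, 0) + (0, e) := by simp
  set N := SLn.lower y.2 with hN
  set L := A.minusAt (cellSection hρ p y)
    (modelDeriv (FlagModel n) F (cellSection hρ p) y (1, 0)) with hL
  have hv : (A.minusAt (cellSection hρ p y)
      (modelDeriv (FlagModel n) F (cellSection hρ p) y (0, e))).1 =
        (N⁻¹).1 * SLn.lowMatrix n e := by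
    change (projMinus n (A.formAt _ _)).1 = _
    rw [formAt_cellSection_vertical hρ A hy]
    exact SLn.projMinus_val_of_mem
      (SLn.mul_mem_nMinus (fun i j h => SLn.lower_inv_apply_of_lt _ h) (SLn.lowMatrix_mem e))
  have hs : (A.minusAt (cellSection hρ p y)
      (modelDeriv (FlagModel n) F (cellSection hρ p) y (ζ, e))).1 =
        ζ • L.1 + (N⁻¹).1 * SLn.lowMatrix n e := by
    rw [hc, map_add, map_smul, map_add, map_smul, Submodule.coe_add, Submodule.coe_smul, hv]
  have h1 : N.1 * (N⁻¹).1 = 1 := congrArg Subtype.val (mul_inv_cancel N)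
  have h2 : (N⁻¹).1 * N.1 = 1 := congrArg Subtype.val (inv_mul_cancel N)
  have hNL : SLn.lowMatrix n (SLn.lowEntries n (N.1 * L.1)) = N.1 * L.1 :=
    SLn.lowMatrix_lowEntries (SLn.mul_mem_nMinus (fun i j h => SLn.lower_apply_of_lt _ h) L.2)
  have hsl : slope hρ A p y = -SLn.lowEntries n (N.1 * L.1) := rfl
  rw [← Submodule.coe_eq_zero, hs, hsl]
  constructor
  · intro h
    have h3 := congrArg (fun B => SLn.lowEntries n (N.1 * B)) h
    simp only [Matrix.mul_add, Matrix.mul_smul, ← Matrix.mul_assoc, h1, Matrix.one_mul, map_add,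
      map_smul, SLn.lowEntries_lowMatrix, Matrix.mul_zero, map_zero] at h3
    refine Prod.ext (by simp) ?_
    rw [Prod.smul_mk, smul_neg]
    exact eq_neg_of_add_eq_zero_right h3
  · intro h
    have he : e = ζ • -SLn.lowEntries n (N.1 * L.1) := congrArg Prod.snd h
    rw [he, smul_neg, map_neg, map_smul, hNL, Matrix.mul_neg, Matrix.mul_smul, ← Matrix.mul_assoc,
      h2, Matrix.one_mul, add_neg_cancel]

theorem contDiffOn_slope (p : P) :
    ContDiffOn ℂ ω (slope hρ A p) (cellTarget hρ p) := by
  have hT := isOpen_cellTarget hρ p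
  have hL : ∀ i j, ContDiffOn ℂ ω (fun y => A.formAt (cellSection hρ p y)
      (modelDeriv (FlagModel n) F (cellSection hρ p) y (1, 0)) i j) (cellTarget hρ p) := by
    intro i j
    have ht := (contMDiffOn_cellSection hρ p).contMDiffOn_tangentMapWithin (m := ω) (by simp)
      hT.uniqueMDiffOn
    have hc : ContMDiffOn 𝓘(ℂ, FlagModel n) 𝓘(ℂ, FlagModel n).tangent ω
        (fun y => (⟨y, ((1, 0) : FlagModel n)⟩ : TangentBundle 𝓘(ℂ, FlagModel n) (FlagModel n)))
        (cellTarget hρ p) :=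
      contMDiffOn_vectorSpace_iff_contDiffOn.2 contDiffOn_const
    rw [← contMDiffOn_iff_contDiffOn]
    refine (((A.holomorphic i j).comp_contMDiffOn ht).comp hc fun y hy => hy).congr
      fun y hy => ?_
    simp only [Function.comp_apply]
    rw [tangentMapWithin_eq_tangentMap (hT.uniqueMDiffOn _ hy)
      (mdifferentiableAt_cellSection hρ hy)]
    rfl
  rw [contDiffOn_pi]
  rintro ⟨⟨i, j⟩, hq⟩
  change ContDiffOn ℂ ω (fun y : FlagModel n => -(∑ k, (SLn.lower y.2).1 i k *
    (if j < k then A.formAt (cellSection hρ p y)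
      (modelDeriv (FlagModel n) F (cellSection hρ p) y (1, 0)) k j else 0))) _
  refine (ContDiffOn.sum fun k _ => ContDiffOn.mul ?_ ?_).neg
  · exact (((SLn.contMDiff_entry i k).comp SLn.contMDiff_lower).contDiff.comp
      contDiff_snd).contDiffOn
  · split_ifs
    · exact hL k j
    · exact contDiffOn_const

/-- The holomorphic vector field with base coordinate `1` spanning the foliation over the chart
domain around the class of `p`. -/
def leafField (p : P) (x : FlagBundle hρ) : FlagModel n :=
  modelDeriv (FlagModel n) (FlagModel n) (chart hρ p).symm (chart hρ p x)
    (1, slope hρ A p (chart hρ p x))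

theorem contMDiffOn_leafField (p : P) :
    ContMDiffOn 𝓘(ℂ, FlagModel n) 𝓘(ℂ, FlagModel n).tangent ω
      (fun x => (⟨x, leafField hρ A p x⟩ : TangentBundle 𝓘(ℂ, FlagModel n) (FlagBundle hρ)))
      (chart hρ p).source := by
  have hT := isOpen_cellTarget hρ p
  have hsymm : ContMDiffOn 𝓘(ℂ, FlagModel n) 𝓘(ℂ, FlagModel n) ω (chart hρ p).symm
      (cellTarget hρ p) :=
    (contMDiff_proj hρ).comp_contMDiffOn (contMDiffOn_cellSection hρ p)
  have ht := hsymm.contMDiffOn_tangentMapWithin (m := ω) (by simp) hT.uniqueMDiffOn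
  have hc : ContMDiffOn 𝓘(ℂ, FlagModel n) 𝓘(ℂ, FlagModel n).tangent ω
      (fun y => (⟨y, ((1, slope hρ A p y) : FlagModel n)⟩ :
        TangentBundle 𝓘(ℂ, FlagModel n) (FlagModel n)))
      (cellTarget hρ p) :=
    contMDiffOn_vectorSpace_iff_contDiffOn.2 (contDiffOn_const.prodMk (contDiffOn_slope hρ A p))
  refine ((ht.comp hc fun y hy => hy).comp (contMDiffOn_chart_source hρ p)
    fun x hx => (chart hρ p).map_source hx).congr fun x hx => ?_
  have hy : chart hρ p x ∈ cellTarget hρ p := (chart hρ p).map_source hx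
  have hmk : ∀ (x' : FlagBundle hρ) (u : FlagModel n), x' = x →
      (⟨x, u⟩ : TangentBundle 𝓘(ℂ, FlagModel n) (FlagBundle hρ)) = ⟨x', u⟩ := by
    rintro x' u rfl; rfl
  simp only [Function.comp_apply]
  rw [tangentMapWithin_eq_tangentMap (hT.uniqueMDiffOn _ hy)
    ((hsymm.contMDiffAt (hT.mem_nhds hy)).mdifferentiableAt (by simp))]
  exact hmk _ _ ((chart hρ p).left_inv hx)

theorem leafField_spans (p : P) {x : FlagBundle hρ} (hx : x ∈ (chart hρ p).source) :
    leafField hρ A p x ≠ 0 ∧ ∀ w : FlagModel n,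
      (⟨x, w⟩ : TangentBundle 𝓘(ℂ, FlagModel n) (FlagBundle hρ)) ∈ inducedFoliation hρ A ↔
        ∃ c : ℂ, w = c • leafField hρ A p x := by
  obtain ⟨y, hy, rfl⟩ : ∃ y ∈ cellTarget hρ p, proj hρ (cellSection hρ p y) = x :=
    ⟨chart hρ p x, (chart hρ p).map_source hx, (chart hρ p).left_inv hx⟩
  -- `τ` is the inverse of the chart, written as a composition through `P`
  set τ : FlagModel n → FlagBundle hρ := fun y => proj hρ (cellSection hρ p y) with hτ
  have hyx : chart hρ p (τ y) = y := (chart hρ p).right_inv hy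
  have hchart : MDifferentiableAt 𝓘(ℂ, FlagModel n) 𝓘(ℂ, FlagModel n) (chart hρ p) (τ y) :=
    ((contMDiffOn_chart_source hρ p).contMDiffAt
      ((chart hρ p).open_source.mem_nhds hx)).mdifferentiableAt (by simp)
  have hσ := mdifferentiableAt_cellSection hρ hy
  have hτd : MDifferentiableAt 𝓘(ℂ, FlagModel n) 𝓘(ℂ, FlagModel n) τ y :=
    (mdifferentiable_proj hρ _).comp y hσ
  have hDτ : ∀ c, modelDeriv (FlagModel n) (FlagModel n) τ y c =
      modelDeriv F (FlagModel n) (proj hρ) (cellSection hρ p y)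
        (modelDeriv (FlagModel n) F (cellSection hρ p) y c) :=
    modelDeriv_comp (FlagModel n) F (FlagModel n) rfl (mdifferentiable_proj hρ _) hσ
  have hZ : leafField hρ A p (τ y) =
      modelDeriv (FlagModel n) (FlagModel n) τ y (1, slope hρ A p y) := by
    unfold leafField
    rw [hyx]
    rfl
  have hinj : ∀ c, modelDeriv (FlagModel n) (FlagModel n) (chart hρ p) (τ y)
      (modelDeriv (FlagModel n) (FlagModel n) τ y c) = c := by
    intro c
    rw [← modelDeriv_comp (FlagModel n) (FlagModel n) (FlagModel n) rfl hchart hτd,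
      modelDeriv_congr (FlagModel n) (FlagModel n) (g := id), modelDeriv_id]
    · rfl
    · exact Filter.eventually_of_mem ((isOpen_cellTarget hρ p).mem_nhds hy)
        fun z hz => (chart hρ p).right_inv hz
  have hsurj : ∀ w, modelDeriv (FlagModel n) (FlagModel n) τ y
      (modelDeriv (FlagModel n) (FlagModel n) (chart hρ p) (τ y) w) = w := by
    intro w
    rw [← modelDeriv_comp (FlagModel n) (FlagModel n) (FlagModel n) hyx hτd hchart,
      modelDeriv_congr (FlagModel n) (FlagModel n) (g := id), modelDeriv_id]
    · rfl
    · exact Filter.eventually_of_mem ((chart hρ p).open_source.mem_nhds hx)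
        fun z hz => (chart hρ p).left_inv hz
  have hmem : ∀ c, (⟨τ y, modelDeriv (FlagModel n) (FlagModel n) τ y c⟩ :
      TangentBundle 𝓘(ℂ, FlagModel n) (FlagBundle hρ)) ∈ inducedFoliation hρ A ↔
        c = c.1 • (1, slope hρ A p y) := by
    intro c
    rw [← minusAt_cellSection_eq_zero_iff hρ A hy, hDτ]
    exact mem_inducedFoliation_iff_minusAt hρ A _ _
  change leafField hρ A p (τ y) ≠ 0 ∧ ∀ w : FlagModel n,
      (⟨τ y, w⟩ : TangentBundle 𝓘(ℂ, FlagModel n) (FlagBundle hρ)) ∈ inducedFoliation hρ A ↔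
        ∃ c : ℂ, w = c • leafField hρ A p (τ y)
  rw [hZ]
  refine ⟨fun h0 => ?_, fun w => ⟨fun hw => ?_, ?_⟩⟩
  · have h := hinj (1, slope hρ A p y)
    rw [h0, map_zero] at h
    exact zero_ne_one (congrArg Prod.fst h)
  · rw [← hsurj w, hmem] at hw
    set c := modelDeriv (FlagModel n) (FlagModel n) (chart hρ p) (τ y) w with hc
    refine ⟨c.1, ?_⟩
    rw [← map_smul, ← hw, hc, hsurj]
  · rintro ⟨c, rfl⟩
    rw [← map_smul, hmem]
    simp

theorem isHolomorphicFoliationByCurves_inducedFoliation :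
    IsHolomorphicFoliationByCurves (inducedFoliation hρ A) := by
  intro x
  obtain ⟨p, rfl⟩ : ∃ p, proj hρ p = x := ⟨Quotient.out x, Quotient.out_eq x⟩
  exact ⟨(chart hρ p).source, leafField hρ A p, (chart hρ p).open_source, proj_mem_source hρ p,
    contMDiffOn_leafField hρ A p, fun y hy => leafField_spans hρ A p hy⟩

end FlagBundle

end

theorem mainTheorem3
    {n : ℕ} [NeZero n]
    {C : Type*} [TopologicalSpace C] [ChartedSpace ℂ C] [IsManifold 𝓘(ℂ) ω C]
    {F : Type*} [NormedAddCommGroup F] [NormedSpace ℂ F]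
    {P : Type*} [TopologicalSpace P] [ChartedSpace F P] [IsManifold 𝓘(ℂ, F) ω P]
    [MulAction (SLn n)ᵐᵒᵖ P]
    (ρ : P → C) (hρ : IsHolomorphicPrincipalBundle n F ρ)
    (A : HolomorphicConnection n F P) :
    -- `ω⁻` vanishes on the fundamental vector fields of `𝔟⁺`
    (∀ (p : P) (u : TangentSpace 𝓘(ℂ, SLModel n) (1 : SLn n)),
      SLn.lieMatrix u ∈ bPlus n → A.minus _ (fundamentalField F p u) = 0) ∧
    -- `ω⁻` is horizontal for `P → X`
    (∀ (p : P) (v : TangentSpace 𝓘(ℂ, F) p),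
      mfderiv 𝓘(ℂ, F) 𝓘(ℂ, FlagModel n) (FlagBundle.proj hρ) p v = 0 → A.minus p v = 0) ∧
    -- the direct image of the horizontal distribution is a holomorphic foliation, which at a
    -- point of `X` can be computed from any point of `P` above it
    IsHolomorphicFoliationByCurves (FlagBundle.inducedFoliation hρ A) ∧
    (∀ (p : P) (w : TangentSpace 𝓘(ℂ, FlagModel n) (FlagBundle.proj hρ p)),
      (⟨FlagBundle.proj hρ p, w⟩ : TangentBundle 𝓘(ℂ, FlagModel n) (FlagBundle hρ)) ∈
          FlagBundle.inducedFoliation hρ A ↔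
        ∃ v : TangentSpace 𝓘(ℂ, F) p, A.form p v = 0 ∧
          mfderiv 𝓘(ℂ, F) 𝓘(ℂ, FlagModel n) (FlagBundle.proj hρ) p v = w) ∧
    -- `ω⁻` descends to a unique form on `X`, which is holomorphic and whose kernel is the foliation
    ∃ θ : FlagBundle.AssocForm hρ,
      θ.PullsBackToMinus A ∧
      (∀ θ' : FlagBundle.AssocForm hρ, θ'.PullsBackToMinus A → θ' = θ) ∧
      θ.IsHolomorphic ∧
      FlagBundle.inducedFoliation hρ A = {w | θ w.proj w.snd = 0} := by
  refine ⟨fun p u hu => ?_, fun p v hv => ?_,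
    FlagBundle.isHolomorphicFoliationByCurves_inducedFoliation hρ A, fun p w => ?_,
    FlagBundle.minusForm hρ A, FlagBundle.minusForm_proj hρ A,
    fun θ hθ => FlagBundle.eq_minusForm hρ A hθ, FlagBundle.isHolomorphic_minusForm hρ A, ?_⟩
  · refine (A.minusAt_eq_zero_iff _ _).2 ?_
    have h : A.formAt _ (fundamentalField F p u) = SLn.lieMatrix u :=
      A.form_fundamentalField p u
    rwa [h]
  · exact (FlagBundle.minusAt_eq_of_proj hρ A (hv.trans (map_zero _).symm)).trans (map_zero _)
  · refine (FlagBundle.mem_inducedFoliation_iff_exists hρ A p w).trans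
      (exists_congr fun v => and_congr_left' ?_)
    exact Submodule.coe_eq_zero
  · ext ⟨x, w⟩
    obtain ⟨p, rfl⟩ : ∃ p, FlagBundle.proj hρ p = x := ⟨Quotient.out x, Quotient.out_eq x⟩
    obtain ⟨v, rfl⟩ : ∃ v : F, modelDeriv F (FlagModel n) (FlagBundle.proj hρ) p v = w :=
      ⟨_, FlagBundle.modelDeriv_proj_localSection hρ p w⟩
    exact (FlagBundle.mem_inducedFoliation_iff_minusAt hρ A p v).trans
      (FlagBundle.minusForm_eq_zero_iff hρ A p v).symm
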